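/- Let $p$ be a prime, let $k$ and $\mathbb{F}$ be finite fields of characteristic $p$, and let $e\ge 1$ be an integer. Put $\mathfrak{S}_{\mathbb{F}}=k[[u]]\otimes_{\mathbb{F}_p}\mathbb{F}=(k\otimes_{\mathbb{F}_p}\mathbb{F})[[u]]$, with the Frobenius $\varphi$ which is the $p$-th power map on $k$, the identity on $\mathbb{F}$, and sends $u\mapsto u^p$. A Breuil--Kisin module over $\mathbb{F}$ is a finite projective $\mathfrak{S}_{\mathbb{F}}$-module $\mathfrak{M}$ with a $\varphi$-semilinear map $\varphi:\mathfrak{M}\to\mathfrak{M}$ such that, writing $\varphi(\mathfrak{M})$ for its image and $\mathfrak{M}^\varphi$ for the $\mathfrak{S}_{\mathbb{F}}$-submodule generated by $\varphi(\mathfrak{M})$, the quotient $\mathfrak{M}/\mathfrak{M}^\varphi$ is killed by a power of $u$. Let $\operatorname{Mod}_{\mathcal{F}}$ be the category of pairs $(\mathfrak{M},\mathcal{F})$ with $\mathfrak{M}$ a Breuil--Kisin module over $\mathbb{F}$ and $\mathcal{F}$ a sequence of $\mathfrak{S}_{\mathbb{F}}$-submodules $$u^{e+p-1}\mathfrak{M}=\mathcal{F}^e\subset\ldots\subset\mathcal{F}^1\subset\mathcal{F}^0=\mathfrak{M}^\varphi$$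 with $u^p\mathcal{F}^0\subset\mathcal{F}^1\subset\mathcal{F}^0$ and $u\mathcal{F}^{i-1}\subset\mathcal{F}^i\subset\mathcal{F}^{i-1}$ for $i=2,\ldots,e$; morphisms are $\varphi$-equivariant $\mathfrak{S}_{\mathbb{F}}$-linear maps respecting the filtrations. The object $(\mathfrak{M},\mathcal{F})$ is strongly divisible if there are an $\mathbb{F}_p[[u^p]]$-basis $(e_i)$ of $\varphi(\mathfrak{M})$ and integers $r_i\in[0,p]$ such that $\mathcal{F}^1$ is generated over $\mathbb{F}_p[[u]]$ by the elements $u^{r_i}e_i$. For $i\in\mathbb{Z}$ let $\operatorname{Fil}^i(\overline{\mathfrak{M}})$ be the image of $\mathfrak{M}^\varphi\cap u^i\mathcal{F}^1$ (intersection inside $\mathfrak{M}[1/u]$) in $\overline{\mathfrak{M}}=\mathfrak{M}^\varphi/u\mathfrak{M}^\varphi$, and let $\operatorname{gr}^i(\overline{\mathfrak{M}})=\operatorname{Fil}^i(\overline{\mathfrak{M}})/\operatorname{Fil}^{i+1}(\overline{\mathfrak{M}})$. Let $0\to(\mathfrak{M},\mathcal{E})\to(\mathfrak{N},\mathcal{F})\to(\mathfrak{P},\mathcal{G})\to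 0$ be an exact sequence in $\operatorname{Mod}_{\mathcal{F}}$, that is, a sequence of morphisms for which $0\to\mathcal{E}^i\to\mathcal{F}^i\to\mathcal{G}^i\to 0$ is exact for every $0\le i\le e$. Suppose that $(\mathfrak{N},\mathcal{F})$ is strongly divisible. Then: 1. $(\mathfrak{M},\mathcal{E})$ and $(\mathfrak{P},\mathcal{G})$ are strongly divisible. 2. For each $i\in\mathbb{Z}$ the induced sequence $0\to\operatorname{gr}^i(\overline{\mathfrak{M}})\to\operatorname{gr}^i(\overline{\mathfrak{N}})\to\operatorname{gr}^i(\overline{\mathfrak{P}})\to 0$ is exact. 3. There is an $\mathfrak{S}_{\mathbb{F}}$-linear splitting $s:\mathfrak{P}^\varphi\to\mathfrak{N}^\varphi$ of the induced surjection $\mathfrak{N}^\varphi\to\mathfrak{P}^\varphi$ such that $s(\mathcal{G}^1)\subset\mathcal{F}^1$ and $s(\varphi(\mathfrak{P}))\subset\varphi(\mathfrak{N})$. -/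

import Mathlib

open scoped TensorProduct PowerSeries Pointwise

noncomputable section

namespace BreuilKisin

/-! ### The coefficient ring and its Frobenius -/

/-- The ring `𝔖_𝔽 = (W(k)⟦u⟧) ⊗_{ℤ_p} 𝔽 = k⟦u⟧ ⊗_{𝔽_p} 𝔽`, written as `(k ⊗_{𝔽_p} 𝔽)⟦u⟧`
(the two agree since `𝔽` is finite over `𝔽_p`). -/
abbrev SF (p : ℕ) (k F : Type*) [Field k] [Field F] [Algebra (ZMod p) k] [Algebra (ZMod p) F] :
    Type _ :=
  PowerSeries (k ⊗[ZMod p] F)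

section Ring

variable (p : ℕ) [Fact p.Prime] (k F : Type*) [Field k] [Field F] [Algebra (ZMod p) k]
  [Algebra (ZMod p) F]

/-- The variable `u`. -/
def u : SF p k F := PowerSeries.X

/-- The `𝔽`-linear extension to `k ⊗ 𝔽` of the `p`-power Frobenius of `k`. -/
def coeffFrob : (k ⊗[ZMod p] F) →ₐ[ZMod p] (k ⊗[ZMod p] F) :=
  Algebra.TensorProduct.map (FiniteField.frobeniusAlgHom (ZMod p) k) (AlgHom.id (ZMod p) F)

theorem coeffFrob_tmul (a : k) (b : F) :
    coeffFrob p k F (a ⊗ₜ[ZMod p] b) = (a ^ p) ⊗ₜ[ZMod p] b := by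
  simp [coeffFrob, ZMod.card]

/-- The Frobenius `φ` of `𝔖_𝔽`: the `p`-power map on `k`, the identity on `𝔽`, and `u ↦ u ^ p`. -/
def phi : SF p k F →+* SF p k F :=
  ((PowerSeries.expand p (Fact.out : p.Prime).ne_zero :
      SF p k F →ₐ[k ⊗[ZMod p] F] SF p k F) : SF p k F →+* SF p k F).comp
    (PowerSeries.map (coeffFrob p k F : (k ⊗[ZMod p] F) →+* (k ⊗[ZMod p] F)))

/-- The subring `𝔽_p⟦u⟧` of `𝔖_𝔽`. -/
def Fpu : Subring (SF p k F) :=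
  (PowerSeries.map (algebraMap (ZMod p) (k ⊗[ZMod p] F))).range

/-- The subring `𝔽_p⟦u^p⟧` of `𝔖_𝔽`. -/
def Fpup : Subring (SF p k F) :=
  ((PowerSeries.map (algebraMap (ZMod p) (k ⊗[ZMod p] F))).comp
    ((PowerSeries.expand p (Fact.out : p.Prime).ne_zero :
      PowerSeries (ZMod p) →ₐ[ZMod p] PowerSeries (ZMod p)) :
        PowerSeries (ZMod p) →+* PowerSeries (ZMod p))).range

theorem phi_u : phi p k F (u p k F) = u p k F ^ p := by
  simp [phi, u]

variable {p k F} in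
/-- `𝔽_p⟦u^p⟧` is contained in `φ(𝔖_𝔽)`, as `φ` sends `a(u)` to `a(u^p)` for `a ∈ 𝔽_p⟦u⟧`. -/
theorem exists_phi_eq_of_mem_Fpup {c : SF p k F} (hc : c ∈ Fpup p k F) :
    ∃ d, phi p k F d = c := by
  obtain ⟨a, rfl⟩ := hc
  refine ⟨PowerSeries.map (algebraMap (ZMod p) (k ⊗[ZMod p] F)) a, ?_⟩
  have h : PowerSeries.map (coeffFrob p k F : (k ⊗[ZMod p] F) →+* (k ⊗[ZMod p] F))
      (PowerSeries.map (algebraMap (ZMod p) (k ⊗[ZMod p] F)) a) =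
      PowerSeries.map (algebraMap (ZMod p) (k ⊗[ZMod p] F)) a := by
    ext n
    simp only [PowerSeries.coeff_map]
    exact AlgHom.commutes (coeffFrob p k F) _
  simp only [phi, RingHom.comp_apply, h]
  simp [PowerSeries.map_expand]

end Ring

/-! ### The category of filtered mod `p` Breuil--Kisin modules -/

/-- An object `(𝔐, 𝓕)` of the category `Mod_𝓕` (with ramification degree `e`).

The linearised Frobenius `𝔐 ⊗_{𝔖,φ} 𝔖 → 𝔐` is recorded as the corresponding `φ`-semilinear map
`frob : 𝔐 → 𝔐`; its image `𝔐^φ` is the `𝔖_𝔽`-span of the image of `frob`.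
Only the terms `fil i` with `i ≤ e` are meaningful; nothing below uses the others. -/
structure ModF (p : ℕ) [Fact p.Prime] (k F : Type*) [Field k] [Field F] [Algebra (ZMod p) k]
    [Algebra (ZMod p) F] (e : ℕ) where
  carrier : Type*
  [addCommGroup : AddCommGroup carrier]
  [module : Module (SF p k F) carrier]
  [finite : Module.Finite (SF p k F) carrier]
  [projective : Module.Projective (SF p k F) carrier]
  frob : carrier →ₛₗ[phi p k F] carrier
  /-- the cokernel of the linearised Frobenius is killed by a power of `u` -/
  height : ∃ h : ℕ, ∀ m : carrier,
    u p k F ^ h • m ∈ Submodule.span (SF p k F) (Set.range frob)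
  fil : ℕ → Submodule (SF p k F) carrier
  fil_zero : fil 0 = Submodule.span (SF p k F) (Set.range frob)
  fil_e : fil e = u p k F ^ (e + p - 1) • (⊤ : Submodule (SF p k F) carrier)
  fil_one : u p k F ^ p • fil 0 ≤ fil 1 ∧ fil 1 ≤ fil 0
  fil_succ : ∀ i, 1 ≤ i → i < e → u p k F • fil i ≤ fil (i + 1) ∧ fil (i + 1) ≤ fil i

attribute [instance] ModF.addCommGroup ModF.module ModF.finite ModF.projective

section Mod

variable {p : ℕ} [Fact p.Prime] {k F : Type*} [Field k] [Field F] [Algebra (ZMod p) k]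
  [Algebra (ZMod p) F] {e : ℕ}

namespace ModF

/-- `𝔐^φ`, the image of the linearised Frobenius. -/
def mphi (M : ModF p k F e) : Submodule (SF p k F) M.carrier :=
  Submodule.span (SF p k F) (Set.range M.frob)

/-- `φ(𝔐)`, the image of the semilinear Frobenius, as a module over `𝔽_p⟦u^p⟧`. -/
def phiM (M : ModF p k F e) : Submodule (Fpup p k F) M.carrier where
  carrier := Set.range M.frob
  add_mem' := by
    rintro _ _ ⟨a, rfl⟩ ⟨b, rfl⟩
    exact ⟨a + b, map_add _ _ _⟩
  zero_mem' := ⟨0, map_zero _⟩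
  smul_mem' := by
    rintro ⟨c, hc⟩ _ ⟨a, rfl⟩
    obtain ⟨d, rfl⟩ := exists_phi_eq_of_mem_Fpup hc
    exact ⟨d • a, M.frob.map_smulₛₗ d a⟩

/-- Strong divisibility: there are an `𝔽_p⟦u^p⟧`-basis `(e_i)` of `φ(𝔐)` and integers
`r_i ∈ [0, p]` such that `𝓕^1` is generated over `𝔽_p⟦u⟧` by the `u ^ (r_i) e_i`. -/
def IsStronglyDivisible (M : ModF p k F e) : Prop :=
  ∃ (n : ℕ) (b : Module.Basis (Fin n) (Fpup p k F) M.phiM) (r : Fin n → ℕ),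
    (∀ i, r i ≤ p) ∧
      (M.fil 1).restrictScalars (Fpu p k F) =
        Submodule.span (Fpu p k F)
          (Set.range fun i => u p k F ^ r i • ((b i : M.phiM) : M.carrier))

/-- `Fil^i(𝔐^φ) = 𝔐^φ ∩ u^i 𝓕^1` for `i ∈ ℤ`, the intersection being taken in `𝔐[1/u]`.
As `𝔐` is `u`-torsion free, `x ∈ u^i 𝓕^1` means `u^(-i) x ∈ 𝓕^1` when `i ≤ 0`. -/
def filPhi (M : ModF p k F e) (i : ℤ) : Submodule (SF p k F) M.carrier :=
  M.mphi ⊓ (u p k F ^ i.toNat • M.fil 1).comap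
    (LinearMap.lsmul (SF p k F) M.carrier (u p k F ^ (-i).toNat))

/-- The reduction `𝔐^φ / u 𝔐^φ`. -/
abbrev Bar (M : ModF p k F e) : Type _ :=
  M.mphi ⧸ (u p k F • (⊤ : Submodule (SF p k F) M.mphi))

/-- `Fil^i` of the reduction: the image of `Fil^i(𝔐^φ)`. -/
def filBar (M : ModF p k F e) (i : ℤ) : Submodule (SF p k F) M.Bar :=
  ((M.filPhi i).submoduleOf M.mphi).map (Submodule.mkQ _)

/-- `gr^i` of the reduction: `Fil^i / Fil^{i+1}`. -/
abbrev Gr (M : ModF p k F e) (i : ℤ) : Type _ :=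
  M.filBar i ⧸ (M.filBar (i + 1)).submoduleOf (M.filBar i)

end ModF

/-! ### Morphisms and exact sequences -/

/-- Morphisms in `Mod_𝓕`: `φ`-equivariant `𝔖_𝔽`-linear maps respecting the filtrations. -/
structure Hom (M N : ModF p k F e) where
  toLin : M.carrier →ₗ[SF p k F] N.carrier
  map_frob : ∀ m, toLin (M.frob m) = N.frob (toLin m)
  map_fil : ∀ i, i ≤ e → ∀ m ∈ M.fil i, toLin m ∈ N.fil i

namespace Hom

variable {M N : ModF p k F e} (f : Hom M N)

/-- The induced map `𝓔^i → 𝓕^i` on the `i`-th step of the filtrations. -/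
def onFil (i : ℕ) (hi : i ≤ e) : M.fil i →ₗ[SF p k F] N.fil i :=
  f.toLin.restrict (f.map_fil i hi)

theorem map_mphi : ∀ m ∈ M.mphi, f.toLin m ∈ N.mphi := by
  intro m hm
  have : M.mphi ≤ N.mphi.comap f.toLin := by
    refine Submodule.span_le.2 ?_
    rintro _ ⟨a, rfl⟩
    exact Submodule.subset_span ⟨f.toLin a, (f.map_frob a).symm⟩
  exact this hm

/-- The induced map `𝔐^φ → 𝔑^φ`. -/
def onPhi : M.mphi →ₗ[SF p k F] N.mphi :=
  f.toLin.restrict f.map_mphi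

theorem map_filPhi (he : 1 ≤ e) (i : ℤ) : ∀ m ∈ M.filPhi i, f.toLin m ∈ N.filPhi i := by
  rintro m ⟨hm, hm'⟩
  refine ⟨f.map_mphi m hm, ?_⟩
  obtain ⟨y, hy, hy'⟩ := hm'
  refine ⟨f.toLin y, f.map_fil 1 he y hy, ?_⟩
  have := congrArg f.toLin hy'
  simpa using this

/-- The induced map on reductions. -/
def onBar : M.Bar →ₗ[SF p k F] N.Bar :=
  Submodule.mapQ _ _ f.onPhi (by
    rintro _ ⟨y, -, rfl⟩
    exact ⟨f.onPhi y, trivial, by simp⟩)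

theorem map_filBar (he : 1 ≤ e) (i : ℤ) : ∀ m ∈ M.filBar i, f.onBar m ∈ N.filBar i := by
  rintro _ ⟨x, hx, rfl⟩
  exact ⟨f.onPhi x, f.map_filPhi he i _ hx, rfl⟩

/-- The induced map on `Fil^i` of the reductions. -/
def onFilBar (he : 1 ≤ e) (i : ℤ) : M.filBar i →ₗ[SF p k F] N.filBar i :=
  f.onBar.restrict (f.map_filBar he i)

/-- The induced map on `gr^i` of the reductions. -/
def onGr (he : 1 ≤ e) (i : ℤ) : M.Gr i →ₗ[SF p k F] N.Gr i :=
  Submodule.mapQ _ _ (f.onFilBar he i) (fun _ hx => f.map_filBar he (i + 1) _ hx)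

end Hom

/-- Exactness of `0 → 𝔐 → 𝔑 → 𝔓 → 0` in `Mod_𝓕`: exactness of `0 → 𝓔^i → 𝓕^i → 𝓖^i → 0`
for all `0 ≤ i ≤ e`. -/
def ShortExact {M N P : ModF p k F e} (f : Hom M N) (g : Hom N P) : Prop :=
  ∀ (i : ℕ) (hi : i ≤ e), Function.Injective (f.onFil i hi) ∧
    Function.Exact (f.onFil i hi) (g.onFil i hi) ∧ Function.Surjective (g.onFil i hi)

end Mod

end BreuilKisin

end

/-! Everything rests on a grading. As `k` is perfect, 𝔖 is generated over φ(𝔖) by 1, u, …, u^(p-1),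
so every element of 𝔐^φ has the form ∑ u^j φ(m_j) with 0 ≤ j < p. Comparing the index of u^p 𝔐^φ in
𝔐^φ with that of u𝔐 in 𝔐 shows that the m_j are unique (`ModF.decomp_frob_injective`). Strong
divisibility is equivalent to homogeneity of 𝓕^1 for the grading 𝔐^φ = ⨁ u^j φ(𝔐)
(`IsStronglyDivisible.isHomogeneous`, `IsHomogeneous.isStronglyDivisible`). A homogeneous 𝓕^1 is
encoded by the submodules `piece j`, an increasing filtration of 𝔐 that contains u𝔐 and reaches 𝔐 at
j = p.

Homogeneity concerns coefficients one at a time, so it passes to sub and quotient: 𝓔^1 consists of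
the elements of 𝔐 that land in 𝓕^1, and elements of 𝓖^1 lift to 𝓕^1 with their coefficients. The
same lifting makes 𝔑 → 𝔓 strict for the filtrations by pieces. Since Fil^(-n) of the reduction is
the image of `piece n` under φ, and Fil^i vanishes for i > 0, strictness yields exactness on graded
pieces.

For the splitting, k ⊗ 𝔽 is semisimple, so 𝔑/u → 𝔓/u has a filtered section. It lifts to a filtered
section t : 𝔓 → 𝔑 because 𝔓 is projective and the pieces contain u𝔑. Then ∑ u^j φ(m_j) ↦ ∑ u^j φ(t
m_j) is the required map. -/

noncomputable section

namespace BreuilKisin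

/-! ### Power series -/

/-- A power series splits according to the residues of its exponents modulo `p`. -/
theorem exists_eq_sum_X_pow_mul_expand {S : Type*} [CommRing S] {p : ℕ} (hp : p ≠ 0) (r : S⟦X⟧) :
    ∃ c : Fin p → S⟦X⟧,
      r = ∑ j : Fin p, PowerSeries.X ^ (j : ℕ) * PowerSeries.expand p hp (c j) := by
  refine ⟨fun j => PowerSeries.mk fun n => PowerSeries.coeff (p * n + j) r, ?_⟩
  ext n
  have hlt : n % p < p := Nat.mod_lt _ (Nat.pos_of_ne_zero hp)
  rw [map_sum, Finset.sum_eq_single ⟨n % p, hlt⟩]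
  · rw [PowerSeries.coeff_X_pow_mul', if_pos (Nat.mod_le _ _)]
    have h : n - n % p = p * (n / p) := by
      have := Nat.mod_add_div n p
      omega
    simp only [h, PowerSeries.coeff_expand_mul, PowerSeries.coeff_mk]
    rw [add_comm, Nat.mod_add_div]
  · intro j _ hj
    rw [PowerSeries.coeff_X_pow_mul']
    split_ifs with hjn
    · refine PowerSeries.coeff_expand_of_not_dvd p hp _ fun hd => hj ?_
      ext
      have h1 := (Nat.modEq_iff_dvd' hjn).2 hd
      have : (j : ℕ) % p = n % p := h1
      rw [Nat.mod_eq_of_lt j.2] at this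
      exact this
    · rfl
  · simp

/-- If `A` is finite over `K` then `A⟦X⟧` is finite over `K⟦X⟧`. -/
theorem exists_eq_sum_map_mul_C {K A : Type*} [Field K] [CommRing A] [Algebra K A]
    [Module.Finite K A] :
    ∃ (n : ℕ) (a : Fin n → A), ∀ f : A⟦X⟧, ∃ c : Fin n → K⟦X⟧,
      f = ∑ i, PowerSeries.map (algebraMap K A) (c i) * PowerSeries.C (a i) := by
  let b := Module.finBasis K A
  refine ⟨_, b, fun f => ⟨fun i => PowerSeries.mk fun n => b.repr (PowerSeries.coeff n f) i, ?_⟩⟩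
  ext n
  rw [map_sum]
  simp only [PowerSeries.coeff_mul_C, PowerSeries.coeff_map, PowerSeries.coeff_mk]
  simp only [← Algebra.smul_def]
  exact (b.sum_repr _).symm

theorem X_mem_jacobson {S : Type*} [CommRing S] :
    (PowerSeries.X : S⟦X⟧) ∈ Ideal.jacobson (⊥ : Ideal S⟦X⟧) := by
  rw [Ideal.mem_jacobson_bot]
  intro y
  rw [PowerSeries.isUnit_iff_constantCoeff]
  simp

/-! ### Frobenius, regularity of u and semisimplicity over 𝔖_𝔽 -/

section Ring

variable (p : ℕ) [Fact p.Prime] (k F : Type*) [Field k] [Field F]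
  [Algebra (ZMod p) k] [Algebra (ZMod p) F]

theorem coeffFrob_bijective [Finite k] : Function.Bijective (coeffFrob p k F) := by
  have h : Function.Bijective (FiniteField.frobeniusAlgHom (ZMod p) k) := by
    rw [← Finite.injective_iff_bijective]
    exact (FiniteField.frobeniusAlgHom (ZMod p) k).toRingHom.injective
  let e : k ≃ₐ[ZMod p] k := AlgEquiv.ofBijective _ h
  have : (coeffFrob p k F) = (Algebra.TensorProduct.congr e AlgEquiv.refl :
      _ ≃ₐ[ZMod p] _).toAlgHom := by
    ext <;> rfl
  rw [this]
  exact (Algebra.TensorProduct.congr e AlgEquiv.refl).bijective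

instance [Finite k] [Finite F] : Finite (k ⊗[ZMod p] F) := Module.finite_of_finite (ZMod p)

/-- Separability of 𝔽 over 𝔽_p makes the tensor product reduced, and it is Artinian. -/
instance [Finite k] [Finite F] : IsSemisimpleRing (k ⊗[ZMod p] F) := by
  have : Algebra.FormallyUnramified (ZMod p) F := Algebra.FormallyUnramified.of_isSeparable _ _
  have : IsReduced (k ⊗[ZMod p] F) := Algebra.FormallyUnramified.isReduced_of_field k _
  exact IsArtinianRing.isSemisimpleRing_of_isReduced _

variable {p k F}

theorem exists_phi_eq_expand [Finite k] (c : SF p k F) : ∃ d, phi p k F d =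
    PowerSeries.expand p (Fact.out : p.Prime).ne_zero c := by
  let e := Equiv.ofBijective _ (coeffFrob_bijective p k F)
  refine ⟨PowerSeries.mk fun n => e.symm (PowerSeries.coeff n c), ?_⟩
  have : PowerSeries.map (coeffFrob p k F : (k ⊗[ZMod p] F) →+* (k ⊗[ZMod p] F))
      (PowerSeries.mk fun n => e.symm (PowerSeries.coeff n c)) = c := by
    ext n
    simp only [PowerSeries.coeff_map, PowerSeries.coeff_mk]
    exact e.apply_symm_apply _
  simp [phi, this]

/-- `𝔖_𝔽` is generated by `1, u, …, u ^ (p - 1)` over `φ(𝔖_𝔽)`. -/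
theorem exists_eq_sum_u_pow_mul_phi [Finite k] (r : SF p k F) :
    ∃ c : Fin p → SF p k F, r = ∑ j : Fin p, u p k F ^ (j : ℕ) * phi p k F (c j) := by
  obtain ⟨c, hc⟩ := exists_eq_sum_X_pow_mul_expand (Fact.out : p.Prime).ne_zero r
  choose d hd using fun j => exists_phi_eq_expand (c j)
  exact ⟨d, by simp only [hd]; exact hc⟩

/-- The inclusion `𝔽_p⟦u⟧ → 𝔖_𝔽`. -/
abbrev baseMap (p : ℕ) [Fact p.Prime] (k F : Type*) [Field k] [Field F]
    [Algebra (ZMod p) k] [Algebra (ZMod p) F] : (ZMod p)⟦X⟧ →+* SF p k F :=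
  PowerSeries.map (algebraMap (ZMod p) (k ⊗[ZMod p] F))

theorem phi_baseMap (c : (ZMod p)⟦X⟧) : phi p k F (baseMap p k F c) =
    baseMap p k F (PowerSeries.expand p (Fact.out : p.Prime).ne_zero c) := by
  have h : PowerSeries.map (coeffFrob p k F : (k ⊗[ZMod p] F) →+* (k ⊗[ZMod p] F))
      (baseMap p k F c) = baseMap p k F c := by
    ext n
    simp only [PowerSeries.coeff_map]
    exact AlgHom.commutes (coeffFrob p k F) _
  simp only [phi, RingHom.comp_apply, h]
  simp [PowerSeries.map_expand]

theorem isSMulRegular_u (M : Type*) [AddCommGroup M] [Module (SF p k F) M]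
    [Module.Projective (SF p k F) M] : IsSMulRegular M (u p k F) := by
  refine Module.Flat.isSMulRegular_of_nonZeroDivisors ?_
  exact MvPowerSeries.X_mem_nonzeroDivisors

theorem isSMulRegular_u_pow (M : Type*) [AddCommGroup M] [Module (SF p k F) M]
    [Module.Projective (SF p k F) M] (n : ℕ) : IsSMulRegular M (u p k F ^ n) :=
  (isSMulRegular_u M).pow n

/-- Modules killed by `u` are semisimple. -/
theorem isSemisimpleModule_of_u_smul_eq_zero [Finite k] [Finite F] (V : Type*)
    [AddCommGroup V] [Module (SF p k F) V]
    (h : ∀ v : V, u p k F • v = 0) : IsSemisimpleModule (SF p k F) V := by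
  let I := RingHom.ker (PowerSeries.constantCoeff (R := k ⊗[ZMod p] F))
  have hV : Module.IsTorsionBySet (SF p k F) V I := by
    rintro v ⟨a, ha⟩
    obtain ⟨b, rfl⟩ := PowerSeries.X_dvd_iff.2 (RingHom.mem_ker.1 ha)
    change (PowerSeries.X * b) • v = 0
    rw [mul_comm, mul_smul]
    exact (congrArg (b • ·) (h v)).trans (smul_zero b)
  have : IsSemisimpleRing (SF p k F ⧸ I) :=
    (RingHom.quotientKerEquivOfSurjective
      (PowerSeries.constantCoeff_surj (R := k ⊗[ZMod p] F))).symm.isSemisimpleRing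
  let _ := hV.module
  exact hV.isSemisimpleModule_iff.1 inferInstance

/-- A finite module over `𝔖_𝔽` has finite reduction modulo `u`. -/
theorem finite_quotient_u [Finite k] [Finite F] (M : Type*) [AddCommGroup M] [Module (SF p k F) M]
    [Module.Finite (SF p k F) M] :
    Finite (M ⧸ (u p k F • (⊤ : Submodule (SF p k F) M))) := by
  obtain ⟨n, f, hf⟩ := Module.Finite.exists_fin' (SF p k F) M
  let A := k ⊗[ZMod p] F
  let g : (Fin n → A) → M ⧸ (u p k F • (⊤ : Submodule (SF p k F) M)) :=
    fun a => Submodule.Quotient.mk (f fun i => PowerSeries.C (a i))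
  refine Finite.of_surjective g fun y => ?_
  obtain ⟨x, rfl⟩ := Submodule.Quotient.mk_surjective _ y
  obtain ⟨v, rfl⟩ := hf x
  refine ⟨fun i => PowerSeries.constantCoeff (v i), ?_⟩
  rw [eq_comm, Submodule.Quotient.eq]
  have : ∀ i, ∃ w : SF p k F, v i - PowerSeries.C (PowerSeries.constantCoeff (v i)) =
      u p k F * w := fun i => PowerSeries.X_dvd_iff.2 (by simp)
  choose w hw using this
  refine ⟨f w, trivial, ?_⟩
  rw [← map_sub, DistribSMul.toLinearMap_apply, ← map_smul]
  congr 1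
  ext1 i
  exact (hw i).symm

end Ring

/-! ### Splittings compatible with filtrations -/

section FilteredSection

variable {R X Y : Type*} [CommRing R] [AddCommGroup X] [Module R X] [AddCommGroup Y] [Module R Y]

theorem exists_projection [IsSemisimpleModule R Y] (S : Submodule R Y) :
    ∃ π : Y →ₗ[R] Y, (∀ y, π y ∈ S) ∧ ∀ y ∈ S, π y = y := by
  obtain ⟨h, hh⟩ := IsSemisimpleModule.extension_property S.subtype S.injective_subtype
    (LinearMap.id : S →ₗ[R] S)
  exact ⟨S.subtype ∘ₗ h, fun y => (h y).2,
    fun y hy => congrArg Subtype.val (LinearMap.congr_fun hh ⟨y, hy⟩)⟩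

theorem exists_section_of_submodule [IsSemisimpleModule R X] [IsSemisimpleModule R Y]
    (g : X →ₗ[R] Y) (hg : Function.Surjective g) (S : Submodule R X) (T : Submodule R Y)
    (h : ∀ y ∈ T, ∃ x ∈ S, g x = y) :
    ∃ s : Y →ₗ[R] X, (∀ y, g (s y) = y) ∧ ∀ y ∈ T, s y ∈ S := by
  obtain ⟨π, hπ, hπ'⟩ := exists_projection T
  obtain ⟨s₀, hs₀⟩ := IsSemisimpleModule.lifting_property g hg LinearMap.id
  -- Restricted to the part of S lying over T, g is onto T, so it has a section s₁ with values in S.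
  let T' := T.comap (g ∘ₗ S.subtype)
  obtain ⟨s₁, hs₁⟩ := IsSemisimpleModule.lifting_property
    ((g ∘ₗ S.subtype).restrict (p := T') (q := T) fun _ hx => hx)
    (by
      rintro ⟨y, hy⟩
      obtain ⟨x, hx, rfl⟩ := h y hy
      exact ⟨⟨⟨x, hx⟩, hy⟩, rfl⟩) LinearMap.id
  let q : Y →ₗ[R] T := π.codRestrict T hπ
  -- Use s₁ on T and an arbitrary section s₀ on the complement of T cut out by π.
  refine ⟨S.subtype ∘ₗ T'.subtype ∘ₗ s₁ ∘ₗ q + s₀ ∘ₗ (LinearMap.id - π), fun y => ?_,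
    fun y hy => ?_⟩
  · have h1 : g (s₁ (q y)) = π y := congrArg Subtype.val (LinearMap.congr_fun hs₁ (q y))
    have h0 : g (s₀ (y - π y)) = y - π y := LinearMap.congr_fun hs₀ _
    simp only [LinearMap.add_apply, LinearMap.comp_apply, Submodule.subtype_apply,
      LinearMap.sub_apply, LinearMap.id_apply, map_add]
    rw [h1, h0, add_sub_cancel]
  · simp [hπ' y hy]

/-- A surjection of semisimple modules which is strict for two filtrations has a filtered
section. -/
theorem exists_filtered_section [IsSemisimpleModule R X] [IsSemisimpleModule R Y]
    (g : X →ₗ[R] Y) (hg : Function.Surjective g) (S : ℕ → Submodule R X) (T : ℕ → Submodule R Y)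
    (hS : Monotone S) (hT : Monotone T) (h : ∀ j, ∀ y ∈ T j, ∃ x ∈ S j, g x = y) (n : ℕ) :
    ∃ s : Y →ₗ[R] X, (∀ y, g (s y) = y) ∧ ∀ j ≤ n, ∀ y ∈ T j, s y ∈ S j := by
  induction n with
  | zero =>
    obtain ⟨s, hs, hs'⟩ := exists_section_of_submodule g hg (S 0) (T 0) (h 0)
    refine ⟨s, hs, fun j hj => ?_⟩
    obtain rfl : j = 0 := by omega
    exact hs'
  | succ n ih =>
    obtain ⟨s, hs, hs'⟩ := ih
    obtain ⟨s₁, hs₁, hs₁'⟩ := exists_section_of_submodule g hg (S (n + 1)) (T (n + 1)) (h _)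
    obtain ⟨π, hπ, hπ'⟩ := exists_projection (T n)
    -- The old section is kept on T n, so the earlier steps are undisturbed; s₁ is used only on a
    -- complement.
    refine ⟨s ∘ₗ π + s₁ ∘ₗ (LinearMap.id - π), fun y => by simp [hs, hs₁], fun j hj y hy => ?_⟩
    rcases Nat.lt_or_ge n j with hnj | hnj
    · obtain rfl : j = n + 1 := by omega
      exact (S _).add_mem (hS n.le_succ (hs' n le_rfl _ (hπ y)))
        (hs₁' _ ((T _).sub_mem hy (hT n.le_succ (hπ y))))
    · simpa [hπ' y (hT hnj hy)] using hs' j hnj y hy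

/-- A surjection onto a projective module which is strict for two filtrations, and such that the
reductions modulo `a` are semisimple, has a filtered section. -/
theorem exists_filtered_section_of_projective [Module.Projective R Y] (a : R)
    [IsSemisimpleModule R (X ⧸ a • (⊤ : Submodule R X))]
    [IsSemisimpleModule R (Y ⧸ a • (⊤ : Submodule R Y))]
    (g : X →ₗ[R] Y) (hg : Function.Surjective g) (S : ℕ → Submodule R X) (T : ℕ → Submodule R Y)
    (hS : Monotone S) (hT : Monotone T) (haS : ∀ j x, a • x ∈ S j)
    (h : ∀ j, ∀ y ∈ T j, ∃ x ∈ S j, g x = y) (n : ℕ) :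
    ∃ s : Y →ₗ[R] X, (∀ y, g (s y) = y) ∧ ∀ j ≤ n, ∀ y ∈ T j, s y ∈ S j := by
  set aX := a • (⊤ : Submodule R X)
  set aY := a • (⊤ : Submodule R Y)
  have hgle : aX ≤ aY.comap g := by
    rintro _ ⟨x, -, rfl⟩
    exact ⟨g x, trivial, by simp⟩
  obtain ⟨s, hs, hs'⟩ := exists_filtered_section (aX.mapQ aY g hgle)
    (by
      intro y
      obtain ⟨y, rfl⟩ := aY.mkQ_surjective y
      obtain ⟨x, rfl⟩ := hg y
      exact ⟨aX.mkQ x, rfl⟩)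
    (fun j => (S j).map aX.mkQ) (fun j => (T j).map aY.mkQ)
    (fun i j hij => Submodule.map_mono (hS hij)) (fun i j hij => Submodule.map_mono (hT hij))
    (by
      rintro j _ ⟨y, hy, rfl⟩
      obtain ⟨x, hx, rfl⟩ := h j y hy
      exact ⟨_, ⟨x, hx, rfl⟩, rfl⟩) n
  -- The lift t is a section only modulo a. The error g ∘ t - id lands in aY = g(aX), so it lifts to
  -- c : Y → aX, and subtracting c is harmless because aX lies in every S j.
  obtain ⟨t, ht⟩ := Module.projective_lifting_property aX.mkQ (s ∘ₗ aY.mkQ) aX.mkQ_surjective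
  have ht' : ∀ y, aX.mkQ (t y) = s (aY.mkQ y) := LinearMap.congr_fun ht
  have hd : ∀ y, (g ∘ₗ t - LinearMap.id : Y →ₗ[R] Y) y ∈ aY := by
    intro y
    rw [← Submodule.Quotient.mk_eq_zero]
    have h1 : aX.mapQ aY g hgle (aX.mkQ (t y)) = aY.mkQ y := by rw [ht', hs]
    simp only [LinearMap.sub_apply, LinearMap.comp_apply, LinearMap.id_apply]
    rw [Submodule.Quotient.mk_sub]
    exact sub_eq_zero.2 h1
  obtain ⟨c, hc⟩ := Module.projective_lifting_property (g.restrict hgle)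
    ((g ∘ₗ t - LinearMap.id).codRestrict aY hd)
    (by
      rintro ⟨_, y, -, rfl⟩
      obtain ⟨x, rfl⟩ := hg y
      exact ⟨⟨a • x, x, trivial, rfl⟩, Subtype.ext (by simp)⟩)
  have hc' : ∀ y, g (c y) = g (t y) - y := fun y => congrArg Subtype.val (LinearMap.congr_fun hc y)
  have haS' : ∀ j, aX ≤ S j := by
    rintro j _ ⟨x, -, rfl⟩
    exact haS j x
  refine ⟨t - aX.subtype ∘ₗ c, fun y => ?_, fun j hj y hy => ?_⟩
  · simp [hc']
  · obtain ⟨x, hx, hxy⟩ := hs' j hj (aY.mkQ y) ⟨y, hy, rfl⟩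
    rw [← ht' y] at hxy
    have h1 : t y - x ∈ S j := haS' j ((Submodule.Quotient.eq aX).1 hxy.symm)
    have h2 : ((c y : aX) : X) ∈ S j := haS' j (c y).2
    have : t y ∈ S j := by simpa using (S j).add_mem h1 hx
    exact (S j).sub_mem this h2

end FilteredSection

/-! ### Bases adapted to a filtration -/

/-- A basis of each step extends to a basis of the next. -/
theorem exists_linearIndepOn_adapted {K V : Type*} [Field K] [AddCommGroup V] [Module K V]
    (T : ℕ → Submodule K V) (hT : Monotone T) (n : ℕ) :
    ∃ B : Set V, LinearIndepOn K id B ∧ B ⊆ T n ∧ ∀ j ≤ n, (T j : Set V) ⊆ Submodule.span K (B ∩ T j) := by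
  induction n with
  | zero =>
    obtain ⟨B, hB, -, hB', hli⟩ := exists_linearIndepOn_id_extension
      (linearIndepOn_empty K (id : V → V)) (Set.empty_subset (T 0 : Set V))
    refine ⟨B, hli, hB, fun j hj => ?_⟩
    obtain rfl : j = 0 := by omega
    rwa [Set.inter_eq_left.2 hB]
  | succ n ih =>
    obtain ⟨B₀, hli₀, hB₀, h₀⟩ := ih
    obtain ⟨B, hB, hsub, hB', hli⟩ := exists_linearIndepOn_id_extension hli₀
      (hB₀.trans (hT n.le_succ))
    refine ⟨B, hli, hB, fun j hj => ?_⟩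
    rcases Nat.lt_or_ge n j with hnj | hnj
    · obtain rfl : j = n + 1 := by omega
      rwa [Set.inter_eq_left.2 hB]
    · exact (h₀ j hnj).trans (Submodule.span_mono (Set.inter_subset_inter_left _ hsub))

/-- A finite flat module over a Noetherian local ring with a filtration containing `𝔪 M` has a
basis adapted to the filtration modulo `𝔪 M`. -/
theorem exists_basis_adapted {O M : Type*} [CommRing O] [IsLocalRing O] [IsNoetherianRing O]
    [AddCommGroup M] [Module O M] [Module.Finite O M] [Module.Flat O M]
    (T : ℕ → Submodule O M) (hT : Monotone T) (n : ℕ) (hn : T n = ⊤) :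
    ∃ (d : ℕ) (b : Module.Basis (Fin d) O M) (r : Fin d → ℕ), (∀ i, r i ≤ n) ∧
      (∀ i, b i ∈ T (r i)) ∧
      ∀ j ≤ n, T j ≤ Submodule.span O (b '' {i | r i ≤ j}) ⊔
        IsLocalRing.maximalIdeal O • (⊤ : Submodule O M) := by
  classical
  have : Module.FinitePresentation O M := Module.finitePresentation_of_finite O M
  let K := IsLocalRing.ResidueField O
  let q : M →ₗ[O] K ⊗[O] M := TensorProduct.mk O K M 1
  have hq : Function.Surjective q := TensorProduct.mk_surjective O M K Ideal.Quotient.mk_surjective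
  have hker : ∀ x, q x = 0 → x ∈ IsLocalRing.maximalIdeal O • (⊤ : Submodule O M) := by
    intro x hx
    have h1 : TensorProduct.quotTensorEquivQuotSMul M (IsLocalRing.maximalIdeal O) (q x) = 0 :=
      (congrArg (TensorProduct.quotTensorEquivQuotSMul M (IsLocalRing.maximalIdeal O)) hx).trans
        (LinearEquiv.map_zero _)
    have h2 : TensorProduct.quotTensorEquivQuotSMul M (IsLocalRing.maximalIdeal O) (q x) =
        Submodule.Quotient.mk ((1 : O) • x) :=
      TensorProduct.quotTensorEquivQuotSMul_mk_tmul _ _ _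
    rw [h2, one_smul, Submodule.Quotient.mk_eq_zero] at h1
    exact h1
  have hspan : ∀ S : Submodule O M, ∀ y ∈ Submodule.span K (q '' S), ∃ x ∈ S, q x = y := by
    intro S y hy
    induction hy using Submodule.span_induction with
    | mem y hy => exact hy
    | zero => exact ⟨0, S.zero_mem, map_zero q⟩
    | add y z _ _ hy hz =>
      obtain ⟨x, hx, rfl⟩ := hy
      obtain ⟨x', hx', rfl⟩ := hz
      exact ⟨x + x', S.add_mem hx hx', map_add _ _ _⟩
    | smul c y _ hy =>
      obtain ⟨x, hx, rfl⟩ := hy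
      obtain ⟨c, rfl⟩ := Ideal.Quotient.mk_surjective c
      refine ⟨c • x, S.smul_mem c hx, ?_⟩
      rw [map_smul]
      exact (IsScalarTower.algebraMap_smul K c (q x)).symm
  obtain ⟨B, hli, -, hB⟩ := exists_linearIndepOn_adapted
    (fun j => Submodule.span K (q '' T j))
    (fun i j hij => Submodule.span_mono (Set.image_mono (hT hij))) n
  have hex : ∀ y : B, ∃ j ≤ n, (y : K ⊗[O] M) ∈ Submodule.span K (q '' T j) := by
    intro y
    refine ⟨n, le_rfl, ?_⟩
    obtain ⟨x, hx⟩ := hq y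
    exact Submodule.subset_span ⟨x, by simp [hn], hx⟩
  have hex' : ∀ y : B, ∃ j, (y : K ⊗[O] M) ∈ Submodule.span K (q '' T j) :=
    fun y => (hex y).imp fun _ h => h.2
  -- The weight of a basis vector is the first step of the filtration containing it.
  let r : B → ℕ := fun y => Nat.find (hex' y)
  have hr : ∀ (y : B) (j : ℕ), (y : K ⊗[O] M) ∈ Submodule.span K (q '' T j) → r y ≤ j :=
    fun y j h => Nat.find_min' _ h
  choose v hv hv' using fun y : B => hspan (T (r y)) y (Nat.find_spec (hex' y))
  have hqv : (q ∘ v) = ((↑) : B → K ⊗[O] M) := funext hv'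
  -- Lifts of a basis of K ⊗ M form a basis of M; flatness supplies the injectivity of 𝔪 ⊗ M → O ⊗
  -- M.
  obtain ⟨b, hb⟩ := Module.exists_basis_of_basis_baseChange v (by
      change LinearIndependent K (q ∘ v)
      rw [hqv]
      exact hli) (by
      change Submodule.span K (Set.range (q ∘ v)) = ⊤
      rw [hqv, Subtype.range_coe, eq_top_iff]
      intro y _
      obtain ⟨x, rfl⟩ := hq y
      exact Submodule.span_mono Set.inter_subset_left
        (hB n le_rfl (Submodule.subset_span ⟨x, by simp [hn], rfl⟩)))
    (Module.Flat.rTensor_preserves_injective_linearMap _ Subtype.val_injective)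
  have : Finite B := Module.Finite.finite_basis b
  obtain ⟨d, ⟨e⟩⟩ := Finite.exists_equiv_fin B
  refine ⟨d, b.reindex e, r ∘ e.symm, fun i => ?_, fun i => ?_, fun j hj x hx => ?_⟩
  · obtain ⟨j, hj, h⟩ := hex (e.symm i)
    exact (hr _ j h).trans hj
  · rw [Module.Basis.reindex_apply, hb]
    exact hv _
  · have h1 : q x ∈ Submodule.span K
        (q '' (Submodule.span O (b.reindex e '' {i | (r ∘ e.symm) i ≤ j}) : Submodule O M)) := by
      refine Submodule.span_mono ?_ (hB j hj (Submodule.subset_span ⟨x, hx, rfl⟩))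
      rintro y ⟨hyB, hy⟩
      refine ⟨v ⟨y, hyB⟩, Submodule.subset_span ⟨e ⟨y, hyB⟩, ?_, ?_⟩, hv' _⟩
      · simpa using hr ⟨y, hyB⟩ j hy
      · simp [hb]
    obtain ⟨z, hz, hzx⟩ := hspan _ _ h1
    rw [Submodule.mem_sup]
    exact ⟨z, hz, x - z, hker _ (by rw [map_sub, hzx, sub_self]), by abel⟩

/-! ### Counting indices -/

section Index

variable {R X : Type*} [CommRing R] [AddCommGroup X] [Module R X] {a : R}

theorem index_smul (ha : IsSMulRegular X a) (L : Submodule R X) :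
    (a • L).toAddSubgroup.index =
      L.toAddSubgroup.index * (a • (⊤ : Submodule R X)).toAddSubgroup.index := by
  let f : X →+ X := DistribSMul.toAddMonoidHom X a
  have h : ∀ S : Submodule R X, (a • S).toAddSubgroup = S.toAddSubgroup.map f := fun _ => rfl
  rw [h, h, ← AddSubgroup.relIndex_mul_index (AddSubgroup.map_mono (f := f)
      (le_top : L.toAddSubgroup ≤ (⊤ : Submodule R X).toAddSubgroup)),
    AddSubgroup.relIndex_map_map_of_injective _ _ (show Function.Injective f from ha)]
  exact congrArg (· * _) (AddSubgroup.relIndex_top_right _)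

theorem index_pow_smul_top (ha : IsSMulRegular X a) (n : ℕ) :
    (a ^ n • (⊤ : Submodule R X)).toAddSubgroup.index =
      (a • (⊤ : Submodule R X)).toAddSubgroup.index ^ n := by
  induction n with
  | zero =>
    rw [pow_zero, pow_zero, one_smul]
    exact AddSubgroup.index_top
  | succ n ih => rw [pow_succ, mul_smul, index_smul (ha.pow n), ih, pow_succ, mul_comm]

/-- The index of `a ^ n L` in `L` only depends on that of `a X` in `X`. -/
theorem relIndex_pow_smul (ha : IsSMulRegular X a)
    (h0 : (a • (⊤ : Submodule R X)).toAddSubgroup.index ≠ 0)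
    (L : Submodule R X) {h : ℕ} (hh : ∀ x : X, a ^ h • x ∈ L) (n : ℕ) :
    (a ^ n • L).toAddSubgroup.relIndex L.toAddSubgroup =
      (a • (⊤ : Submodule R X)).toAddSubgroup.index ^ n := by
  have hLn : (a ^ n • L).toAddSubgroup ≤ L.toAddSubgroup := by
    rintro _ ⟨x, hx, rfl⟩
    exact L.smul_mem _ hx
  have hLh : (a ^ h • (⊤ : Submodule R X)).toAddSubgroup ≤ L.toAddSubgroup := by
    rintro _ ⟨x, -, rfl⟩
    exact hh x
  have h1 := AddSubgroup.relIndex_mul_index hLn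
  rw [index_smul (ha.pow n), index_pow_smul_top ha, mul_comm] at h1
  -- The index of L in X cancels: it is finite because L contains a^h X.
  refine Nat.eq_of_mul_eq_mul_left (Nat.pos_of_ne_zero fun h2 => ?_) h1
  have h3 := AddSubgroup.index_dvd_of_le hLh
  rw [h2, zero_dvd_iff, index_pow_smul_top ha] at h3
  exact pow_ne_zero h h0 h3

end Index

/-! ### The decomposition of `𝔐^φ` -/

section Mod

variable {p : ℕ} [Fact p.Prime] {k F : Type*} [Field k] [Field F] [Algebra (ZMod p) k]
  [Algebra (ZMod p) F] {e : ℕ}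

/-- The map `(m_j) ↦ ∑ u ^ j θ(m_j)` attached to a `φ`-semilinear map `θ`. -/
def decomp {X Q : Type*} [AddCommGroup X] [Module (SF p k F) X] [AddCommGroup Q]
    [Module (SF p k F) Q] (θ : X →ₛₗ[phi p k F] Q) : (Fin p → X) →ₛₗ[phi p k F] Q where
  toFun m := ∑ j : Fin p, u p k F ^ (j : ℕ) • θ (m j)
  map_add' m m' := by simp [Finset.sum_add_distrib]
  map_smul' c m := by
    simp only [Pi.smul_apply, map_smulₛₗ, Finset.smul_sum]
    exact Finset.sum_congr rfl fun j _ => smul_comm _ _ _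

section Decomp

variable {X Q : Type*} [AddCommGroup X] [Module (SF p k F) X] [AddCommGroup Q]
    [Module (SF p k F) Q] (θ : X →ₛₗ[phi p k F] Q)

theorem decomp_apply (m : Fin p → X) :
    decomp θ m = ∑ j : Fin p, u p k F ^ (j : ℕ) • θ (m j) := rfl

theorem decomp_mem_span (m : Fin p → X) :
    decomp θ m ∈ Submodule.span (SF p k F) (Set.range θ) := by
  rw [decomp_apply]
  exact Submodule.sum_mem _ fun _ _ => Submodule.smul_mem _ _ (Submodule.subset_span ⟨_, rfl⟩)

theorem decomp_single (j : Fin p) (x : X) :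
    decomp θ (Pi.single j x) = u p k F ^ (j : ℕ) • θ x := by
  rw [decomp_apply, Finset.sum_eq_single j]
  · simp
  · intro i _ hi
    simp [hi]
  · simp

theorem exists_decomp_eq [Finite k] {x : Q} (hx : x ∈ Submodule.span (SF p k F) (Set.range θ)) :
    ∃ m, decomp θ m = x := by
  have hmul : ∀ (r : SF p k F) (y : X), ∃ m, decomp θ m = r • θ y := by
    intro r y
    obtain ⟨c, hc⟩ := exists_eq_sum_u_pow_mul_phi r
    refine ⟨fun j => c j • y, ?_⟩
    conv_rhs => rw [hc]
    rw [Finset.sum_smul, decomp_apply]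
    exact Finset.sum_congr rfl fun j _ => by
      rw [map_smulₛₗ, mul_smul]
  have hsum : ∀ s : Finset (Fin p), ∀ z : Fin p → Q, (∀ j, ∃ m, decomp θ m = z j) →
      ∃ m, decomp θ m = ∑ j ∈ s, z j := by
    intro s z hz
    choose m hm using hz
    exact ⟨∑ j ∈ s, m j, by simp [hm]⟩
  induction hx using Submodule.span_induction with
  | mem x hx =>
    obtain ⟨y, rfl⟩ := hx
    simpa using hmul 1 y
  | zero => exact ⟨0, map_zero _⟩
  | add x y _ _ hx hy =>
    obtain ⟨m, rfl⟩ := hx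
    obtain ⟨m', rfl⟩ := hy
    exact ⟨m + m', map_add _ _ _⟩
  | smul r x _ hx =>
    obtain ⟨m, rfl⟩ := hx
    rw [decomp_apply, Finset.smul_sum]
    refine hsum _ _ fun j => ?_
    rw [smul_smul]
    exact hmul _ _

end Decomp

namespace ModF

variable (M : ModF p k F e)

theorem decomp_frob_mem (m : Fin p → M.carrier) : decomp M.frob m ∈ M.mphi :=
  decomp_mem_span _ _

/-- A counting argument. Let q be the index of u𝔐 in 𝔐. The preimage of u^p 𝔐^φ under the
decomposition map has index q^p in 𝔐^p. It contains (u𝔐)^p, which has the same finite index, so the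
two coincide. -/
theorem mem_u_smul_of_decomp_mem [Finite k] [Finite F] (m : Fin p → M.carrier)
    (hm : decomp M.frob m ∈ u p k F ^ p • M.mphi) (j : Fin p) :
    m j ∈ u p k F • (⊤ : Submodule (SF p k F) M.carrier) := by
  set uX := u p k F • (⊤ : Submodule (SF p k F) M.carrier)
  have := finite_quotient_u (p := p) (k := k) (F := F) M.carrier
  have hq0 : uX.toAddSubgroup.index ≠ 0 := by
    rw [AddSubgroup.index]
    exact (Nat.card_pos (α := M.carrier ⧸ uX)).ne'
  obtain ⟨h, hh⟩ := M.height
  have hrel := relIndex_pow_smul (isSMulRegular_u M.carrier) hq0 M.mphi hh p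
  let Ψ : (Fin p → M.carrier) →+ M.carrier := (decomp M.frob).toAddMonoidHom
  have hrange : Ψ.range = M.mphi.toAddSubgroup := by
    ext x
    constructor
    · rintro ⟨m, rfl⟩
      exact M.decomp_frob_mem m
    · intro hx
      exact exists_decomp_eq M.frob hx
  let π : (Fin p → M.carrier) →+ (Fin p → M.carrier ⧸ uX) :=
    { toFun := fun m j => uX.mkQ (m j)
      map_zero' := by ext; simp
      map_add' := fun m m' => by ext; simp }
  have hπ : Function.Surjective π := by
    intro y
    choose m hm using fun j => uX.mkQ_surjective (y j)
    exact ⟨m, funext hm⟩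
  have hπi : π.ker.index = uX.toAddSubgroup.index ^ p := by
    rw [AddSubgroup.index_ker, AddMonoidHom.range_eq_top.2 hπ, AddSubgroup.card_top, Nat.card_fun,
      Nat.card_fin]
    rfl
  have hΨi : ((u p k F ^ p • M.mphi).toAddSubgroup.comap Ψ).index = uX.toAddSubgroup.index ^ p := by
    rw [AddSubgroup.index_comap, hrange, hrel]
  have hle : π.ker ≤ (u p k F ^ p • M.mphi).toAddSubgroup.comap Ψ := by
    intro m hm
    have : ∀ j, ∃ y, u p k F • y = m j := by
      intro j
      have : uX.mkQ (m j) = 0 := congrFun hm j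
      rw [Submodule.mkQ_apply, Submodule.Quotient.mk_eq_zero] at this
      obtain ⟨y, -, hy⟩ := this
      exact ⟨y, hy⟩
    choose y hy using this
    obtain rfl : u p k F • y = m := funext hy
    refine ⟨Ψ y, M.decomp_frob_mem y, ?_⟩
    change _ = decomp M.frob (u p k F • y)
    rw [map_smulₛₗ, phi_u]
    rfl
  have h1 := AddSubgroup.relIndex_mul_index hle
  rw [hΨi, hπi] at h1
  have h2 : π.ker.relIndex ((u p k F ^ p • M.mphi).toAddSubgroup.comap Ψ) = 1 :=
    Nat.eq_of_mul_eq_mul_right (Nat.pos_of_ne_zero (pow_ne_zero p hq0)) (by rw [h1, one_mul])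
  rw [AddSubgroup.relIndex_eq_one] at h2
  have h3 : m ∈ π.ker := by
    refine h2 ?_
    exact hm
  exact (Submodule.Quotient.mk_eq_zero _).1 (congrFun h3 j)

/-- Elements of `𝔐^φ` are uniquely of the form `∑ u ^ j φ(m_j)`. -/
theorem decomp_frob_injective [Finite k] [Finite F] : Function.Injective (decomp M.frob) := by
  rw [injective_iff_map_eq_zero]
  let N : Submodule (SF p k F) (Fin p → M.carrier) := LinearMap.ker (decomp M.frob)
  have hN : N = ⊥ := by
    -- Nakayama: a kernel element is u • y, and u^p times the image of y vanishes, so y is again in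
    -- the kernel and N = uN.
    refine Submodule.eq_bot_of_le_smul_of_le_jacobson_bot (Ideal.span {u p k F}) N
      (IsNoetherian.noetherian _) ?_ ?_
    · intro m hm
      have h0 : decomp M.frob m = 0 := hm
      choose y _ hy using M.mem_u_smul_of_decomp_mem m (by rw [h0]; exact zero_mem _)
      obtain rfl : u p k F • y = m := funext hy
      refine Submodule.smul_mem_smul (Ideal.mem_span_singleton_self _) ?_
      rw [map_smulₛₗ, phi_u] at h0
      exact isSMulRegular_u_pow M.carrier p (h0.trans (smul_zero _).symm)
    · rw [Ideal.span_singleton_le_iff_mem]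
      exact X_mem_jacobson
  intro m hm
  have : m ∈ N := hm
  rwa [hN] at this

theorem frob_injective [Finite k] [Finite F] : Function.Injective M.frob := by
  intro x y hxy
  let j : Fin p := ⟨0, (Fact.out : p.Prime).pos⟩
  have := M.decomp_frob_injective (a₁ := Pi.single j x) (a₂ := Pi.single j y)
    (by rw [decomp_single, decomp_single, hxy])
  exact Pi.single_injective j this

end ModF

namespace ModF

variable (M : ModF p k F e)

/-! ### Homogeneity of `𝓕^1` -/

/-- The submodule of those `x ∈ 𝔐` with `u ^ j φ(x) ∈ 𝓕^1`. -/
def piece (j : ℕ) : Submodule (SF p k F) M.carrier where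
  carrier := {x | u p k F ^ j • M.frob x ∈ M.fil 1}
  add_mem' {x y} hx hy := by
    rw [Set.mem_ofPred_eq, map_add, smul_add]
    exact (M.fil 1).add_mem hx hy
  zero_mem' := by simp
  smul_mem' c x hx := by
    rw [Set.mem_ofPred_eq, map_smulₛₗ, smul_comm]
    exact (M.fil 1).smul_mem _ hx

variable {M} in
theorem mem_piece {j : ℕ} {x : M.carrier} :
    x ∈ M.piece j ↔ u p k F ^ j • M.frob x ∈ M.fil 1 := Iff.rfl

theorem piece_mono : Monotone M.piece := by
  intro i j hij x hx
  rw [mem_piece, ← Nat.sub_add_cancel hij, pow_add, mul_smul]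
  exact (M.fil 1).smul_mem _ hx

theorem frob_mem_mphi (x : M.carrier) : M.frob x ∈ M.mphi := Submodule.subset_span ⟨x, rfl⟩

theorem u_pow_smul_mem_fil_one {x : M.carrier} (hx : x ∈ M.mphi) : u p k F ^ p • x ∈ M.fil 1 :=
  M.fil_one.1 (Submodule.smul_mem_pointwise_smul _ _ _ (M.fil_zero ▸ hx))

theorem fil_one_le_mphi : M.fil 1 ≤ M.mphi := M.fil_one.2.trans M.fil_zero.le

theorem piece_eq_top {j : ℕ} (hj : p ≤ j) : M.piece j = ⊤ :=
  top_le_iff.1 (le_trans (fun x _ => M.u_pow_smul_mem_fil_one (M.frob_mem_mphi x))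
    (M.piece_mono hj))

theorem u_smul_mem_piece (j : ℕ) (x : M.carrier) : u p k F • x ∈ M.piece j := by
  rw [mem_piece, map_smulₛₗ, phi_u]
  exact (M.fil 1).smul_mem _ (M.u_pow_smul_mem_fil_one (M.frob_mem_mphi x))

theorem decomp_mem_fil_one {m : Fin p → M.carrier} (hm : ∀ j : Fin p, m j ∈ M.piece j) :
    decomp M.frob m ∈ M.fil 1 := by
  rw [decomp_apply]
  exact Submodule.sum_mem _ fun j _ => hm j

/-- The elements `∑ u ^ j φ(m_j)` of `𝓕^1` all of whose summands lie in `𝓕^1`. -/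
def homogeneousCore : AddSubgroup M.carrier where
  carrier := {x | ∃ m : Fin p → M.carrier, decomp M.frob m = x ∧ ∀ j : Fin p, m j ∈ M.piece j}
  add_mem' := by
    rintro _ _ ⟨m, rfl, hm⟩ ⟨m', rfl, hm'⟩
    exact ⟨m + m', map_add _ _ _, fun j => (M.piece j).add_mem (hm j) (hm' j)⟩
  zero_mem' := ⟨0, map_zero _, fun j => (M.piece j).zero_mem⟩
  neg_mem' := by
    rintro _ ⟨m, rfl, hm⟩
    exact ⟨-m, map_neg _ _, fun j => (M.piece j).neg_mem (hm j)⟩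

theorem u_pow_smul_frob_mem_homogeneousCore {a : ℕ} {x : M.carrier} (hx : x ∈ M.piece a) :
    u p k F ^ a • M.frob x ∈ M.homogeneousCore := by
  have hlt : a % p < p := Nat.mod_lt _ (Fact.out : p.Prime).pos
  -- Whole multiples of p in the exponent are absorbed into φ, leaving an exponent below p.
  have h : u p k F ^ (a % p) • M.frob (u p k F ^ (a / p) • x) = u p k F ^ a • M.frob x := by
    rw [map_smulₛₗ, map_pow, phi_u, smul_smul, ← pow_mul, ← pow_add, Nat.mod_add_div]
  refine ⟨Pi.single ⟨a % p, hlt⟩ (u p k F ^ (a / p) • x), ?_, fun j => ?_⟩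
  · rw [decomp_single, h]
  · rcases eq_or_ne j ⟨a % p, hlt⟩ with rfl | hj
    · rw [Pi.single_eq_same, mem_piece]
      exact h ▸ hx
    · rw [Pi.single_eq_of_ne hj]
      exact zero_mem _

theorem smul_mem_homogeneousCore [Finite k] (r : SF p k F) {x : M.carrier}
    (hx : x ∈ M.homogeneousCore) : r • x ∈ M.homogeneousCore := by
  obtain ⟨m, rfl, hm⟩ := hx
  obtain ⟨c, rfl⟩ := exists_eq_sum_u_pow_mul_phi r
  rw [decomp_apply, Finset.smul_sum]
  refine sum_mem fun j _ => ?_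
  rw [Finset.sum_smul]
  refine sum_mem fun l _ => ?_
  have : (u p k F ^ (l : ℕ) * phi p k F (c l)) • u p k F ^ (j : ℕ) • M.frob (m j) =
      u p k F ^ ((l : ℕ) + j) • M.frob (c l • m j) := by
    rw [map_smulₛₗ, smul_smul, smul_smul]
    congr 1
    ring
  rw [this]
  exact M.u_pow_smul_frob_mem_homogeneousCore
    (M.piece_mono (Nat.le_add_left _ _) ((M.piece j).smul_mem _ (hm j)))

/-- `𝓕^1` is homogeneous for the grading `𝔐^φ = ⨁ u ^ j φ(𝔐)`. -/
def IsHomogeneous : Prop :=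
  ∀ m : Fin p → M.carrier, decomp M.frob m ∈ M.fil 1 → ∀ j : Fin p, m j ∈ M.piece j

/-! ### Strong divisibility is homogeneity -/

variable {M}

/-- The homogeneous core is an 𝔖-submodule containing each generator u^(r_i) e_i, as e_i ∈ φ(𝔐).
Hence it contains 𝓕^1, and uniqueness of coefficients concludes. -/
theorem IsStronglyDivisible.isHomogeneous [Finite k] [Finite F] (h : M.IsStronglyDivisible) :
    M.IsHomogeneous := by
  obtain ⟨n, b, r, hr, hfil⟩ := h
  let H : Submodule (SF p k F) M.carrier :=
    { M.homogeneousCore with smul_mem' := fun r _ hx => M.smul_mem_homogeneousCore r hx }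
  have hgen : ∀ i, u p k F ^ r i • ((b i : M.phiM) : M.carrier) ∈ M.fil 1 := by
    intro i
    change _ ∈ (M.fil 1).restrictScalars (Fpu p k F)
    rw [hfil]
    exact Submodule.subset_span ⟨i, rfl⟩
  have hle : (M.fil 1).restrictScalars (Fpu p k F) ≤ H.restrictScalars (Fpu p k F) := by
    rw [hfil, Submodule.span_le]
    rintro _ ⟨i, rfl⟩
    obtain ⟨x, hx⟩ := (b i).2
    have := hgen i
    rw [← hx] at this
    simp only [← hx]
    exact M.u_pow_smul_frob_mem_homogeneousCore this
  intro m hm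
  obtain ⟨m', hmm', hm'⟩ := hle hm
  obtain rfl := M.decomp_frob_injective hmm'
  exact hm'

/-- Take an 𝔽_p⟦u⟧-basis of 𝔐 adapted to the pieces, with weights r_i ≤ p. Since φ is injective, its
image is an 𝔽_p⟦u^p⟧-basis of φ(𝔐), and the weights are the required exponents. -/
theorem IsHomogeneous.isStronglyDivisible [Finite k] [Finite F] (h : M.IsHomogeneous) :
    M.IsStronglyDivisible := by
  let O := (ZMod p)⟦X⟧
  let _ : Module O M.carrier := Module.compHom _ (baseMap p k F)
  have hsmul : ∀ (c : O) (x : M.carrier), c • x = baseMap p k F c • x := fun _ _ => rfl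
  have : IsScalarTower O (SF p k F) M.carrier := ⟨fun c r x => by
    rw [hsmul, smul_smul, Algebra.smul_def]
    rfl⟩
  have : Module.Finite O (SF p k F) := by
    obtain ⟨n, a, ha⟩ := exists_eq_sum_map_mul_C (K := ZMod p) (A := k ⊗[ZMod p] F)
    classical
    refine ⟨⟨Finset.univ.image fun i => PowerSeries.C (a i), top_le_iff.1 fun f _ => ?_⟩⟩
    obtain ⟨c, rfl⟩ := ha f
    refine Submodule.sum_mem _ fun i _ => ?_
    exact Submodule.smul_mem _ (c i) (Submodule.subset_span (by simp))
  have : Module.Finite O M.carrier := Module.Finite.trans (SF p k F) M.carrier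
  have hreg : ∀ c : O, c ≠ 0 → Function.Injective fun x : M.carrier => c • x := by
    intro c hc x y hxy
    obtain ⟨n, w, rfl⟩ := IsDiscreteValuationRing.eq_unit_mul_pow_irreducible hc
      (PowerSeries.X_irreducible (R := ZMod p))
    have hz : ∀ z : M.carrier, ((w : O) * PowerSeries.X ^ n) • z = (w : O) • u p k F ^ n • z := by
      intro z
      rw [mul_smul, hsmul (PowerSeries.X ^ n), map_pow, PowerSeries.map_X]
      rfl
    simp only [hz] at hxy
    exact isSMulRegular_u_pow M.carrier n (w.isUnit.smul_left_cancel.1 hxy)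
  have : Module.IsTorsionFree O M.carrier :=
    ⟨fun c hc => hreg c hc.ne_zero⟩
  obtain ⟨d, b, r, hr, hb, hT⟩ := exists_basis_adapted
    (fun j => (M.piece j).restrictScalars O) (fun i j hij => M.piece_mono hij) p
    (by rw [M.piece_eq_top le_rfl]; rfl)
  have hmax : ∀ z ∈ IsLocalRing.maximalIdeal O • (⊤ : Submodule O M.carrier),
      ∃ y, u p k F • y = z := by
    intro z hz
    rw [PowerSeries.maximalIdeal_eq_span_X, Submodule.ideal_span_singleton_smul] at hz
    obtain ⟨y, -, rfl⟩ := hz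
    refine ⟨y, ?_⟩
    rw [DistribSMul.toLinearMap_apply, hsmul, PowerSeries.map_X]
    rfl
  let v : Fin d → M.phiM := fun i => ⟨M.frob (b i), b i, rfl⟩
  have hφ : ∀ c : O, baseMap p k F
      (PowerSeries.expand p (Fact.out : p.Prime).ne_zero c) ∈ Fpup p k F := fun c => ⟨c, rfl⟩
  have hfrob : ∀ (c : O) (x : M.carrier), M.frob (c • x) = baseMap p k F
      (PowerSeries.expand p (Fact.out : p.Prime).ne_zero c) • M.frob x := by
    intro c x
    rw [hsmul, map_smulₛₗ, phi_baseMap]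
  have hli : LinearIndependent (Fpup p k F) v := by
    rw [Fintype.linearIndependent_iff]
    intro g hg
    choose c hc using fun i => (g i).2
    have h1 : M.frob (∑ i, c i • b i) = 0 := by
      rw [map_sum]
      have := congrArg Subtype.val hg
      rw [Submodule.coe_sum] at this
      refine Eq.trans (Finset.sum_congr rfl fun i _ => ?_) this
      rw [hfrob]
      exact congrArg (· • M.frob (b i)) (hc i)
    have h2 := Fintype.linearIndependent_iff.1 b.linearIndependent c
      (M.frob_injective (h1.trans (map_zero _).symm))
    intro i
    ext1
    rw [← hc i, h2 i, map_zero]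
    rfl
  have hsp : ⊤ ≤ Submodule.span (Fpup p k F) (Set.range v) := by
    rintro ⟨_, x, rfl⟩ -
    have : (⟨M.frob x, x, rfl⟩ : M.phiM) = ∑ i, (⟨_, hφ (b.repr x i)⟩ : Fpup p k F) • v i := by
      ext1
      rw [Submodule.coe_sum]
      conv_lhs => rw [← b.sum_repr x]
      simp only [map_sum, hfrob]
      rfl
    rw [this]
    exact Submodule.sum_mem _ fun i _ => Submodule.smul_mem _ _ (Submodule.subset_span ⟨i, rfl⟩)
  refine ⟨d, Module.Basis.mk hli hsp, r, hr, ?_⟩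
  simp only [Module.Basis.coe_mk]
  set W := Submodule.span (Fpu p k F)
    (Set.range fun i => u p k F ^ r i • ((v i : M.phiM) : M.carrier))
  have hWsmul : ∀ (c : O) (x : M.carrier), x ∈ W → baseMap p k F c • x ∈ W :=
    fun c x hx => W.smul_mem (⟨_, c, rfl⟩ : Fpu p k F) hx
  have hWu : ∀ (n : ℕ) (x : M.carrier), x ∈ W → u p k F ^ n • x ∈ W := by
    intro n x hx
    have := hWsmul (PowerSeries.X ^ n) x hx
    rwa [map_pow, PowerSeries.map_X] at this
  have hspan : ∀ j, ∀ x ∈ Submodule.span O (b '' {i | r i ≤ j}),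
      u p k F ^ j • M.frob x ∈ W := by
    intro j x hx
    induction hx using Submodule.span_induction with
    | mem x hx =>
      obtain ⟨i, hi, rfl⟩ := hx
      rw [← Nat.sub_add_cancel (show r i ≤ j from hi), pow_add, mul_smul]
      exact hWu _ _ (Submodule.subset_span ⟨i, rfl⟩)
    | zero => simp
    | add x y _ _ hx hy =>
      rw [map_add, smul_add]
      exact W.add_mem hx hy
    | smul c x _ hx =>
      rw [hfrob, smul_comm]
      exact hWsmul _ _ hx
  have hall : ∀ x, u p k F ^ p • M.frob x ∈ W := by
    intro x
    refine hspan p x ?_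
    have : {i | r i ≤ p} = Set.univ := Set.eq_univ_of_forall hr
    rw [this, Set.image_univ, b.span_eq]
    trivial
  apply le_antisymm
  · intro x hx
    obtain ⟨m, rfl⟩ := exists_decomp_eq M.frob (M.fil_one_le_mphi hx)
    rw [decomp_apply]
    refine W.sum_mem fun j _ => ?_
    -- Modulo u𝔐, m_j is a combination of basis vectors of weight at most j. The error uz
    -- contributes u^(j+p) φ(z), which lies in W because all weights are at most p.
    obtain ⟨y, hy, z, hz, hyz⟩ := Submodule.mem_sup.1 (hT j j.2.le (h m hx j))
    obtain ⟨z, rfl⟩ := hmax z hz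
    rw [← hyz, map_add, smul_add]
    refine W.add_mem (hspan _ _ hy) ?_
    rw [map_smulₛₗ, phi_u]
    exact hWu _ _ (hall z)
  · rw [Submodule.span_le]
    rintro _ ⟨i, rfl⟩
    exact hb i

end ModF

instance : NeZero p := ⟨(Fact.out : p.Prime).ne_zero⟩

/-- Multiplication by `u ^ c` permutes the summands of `∑ u ^ j θ(m_j)` cyclically. -/
theorem u_pow_smul_decomp {X Q : Type*} [AddCommGroup X] [Module (SF p k F) X] [AddCommGroup Q]
    [Module (SF p k F) Q] (θ : X →ₛₗ[phi p k F] Q) (c : Fin p) (m : Fin p → X) :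
    u p k F ^ (c : ℕ) • decomp θ m =
      decomp θ fun l => if c ≤ l then m (l - c) else u p k F • m (l - c) := by
  rw [decomp_apply, decomp_apply, Finset.smul_sum]
  refine Fintype.sum_equiv (Equiv.addRight c) _ _ fun j => ?_
  simp only [Equiv.coe_addRight, add_sub_cancel_right, smul_smul, ← pow_add]
  have hval : ((j + c : Fin p) : ℕ) = (j + c) % p := Fin.val_add _ _
  have hj := j.2
  have hc := c.2
  rcases Nat.lt_or_ge ((j : ℕ) + c) p with h | h
  · rw [Nat.mod_eq_of_lt h] at hval
    rw [if_pos (Fin.le_def.2 (by omega)), hval, add_comm]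
  · rw [Nat.mod_eq_sub_mod h, Nat.mod_eq_of_lt (by omega)] at hval
    rw [if_neg (fun h' => by have := Fin.le_def.1 h'; omega), hval, map_smulₛₗ, phi_u, smul_smul,
      ← pow_add]
    congr 2
    omega

namespace ModF

variable (M : ModF p k F e)

/-! ### The filtration on the reduction -/

/-- The class of `φ(x)` in the reduction. -/
def barFrob (x : M.carrier) : M.Bar := Submodule.Quotient.mk ⟨M.frob x, M.frob_mem_mphi x⟩

variable {M}

theorem bar_mk_eq_zero {x : M.mphi} :
    (Submodule.Quotient.mk x : M.Bar) = 0 ↔ ∃ y ∈ M.mphi, u p k F • y = (x : M.carrier) := by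
  rw [Submodule.Quotient.mk_eq_zero]
  constructor
  · rintro ⟨y, -, rfl⟩
    exact ⟨y, y.2, rfl⟩
  · rintro ⟨y, hy, hyx⟩
    exact ⟨⟨y, hy⟩, trivial, Subtype.ext hyx⟩

theorem barFrob_add (x y : M.carrier) : M.barFrob (x + y) = M.barFrob x + M.barFrob y := by
  rw [barFrob, barFrob, barFrob, ← Submodule.Quotient.mk_add]
  congr 1
  exact Subtype.ext (map_add _ _ _)

theorem barFrob_u_smul (x : M.carrier) : M.barFrob (u p k F • x) = 0 := by
  rw [barFrob, bar_mk_eq_zero]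
  refine ⟨u p k F ^ (p - 1) • M.frob x, M.mphi.smul_mem _ (M.frob_mem_mphi x), ?_⟩
  change _ = M.frob _
  rw [smul_smul, ← pow_succ', Nat.sub_add_cancel (Fact.out : p.Prime).one_le, map_smulₛₗ, phi_u]

theorem mk_decomp (m : Fin p → M.carrier) :
    (Submodule.Quotient.mk ⟨decomp M.frob m, M.decomp_frob_mem m⟩ : M.Bar) = M.barFrob (m 0) := by
  rw [barFrob, ← sub_eq_zero, ← Submodule.Quotient.mk_sub, bar_mk_eq_zero]
  refine ⟨∑ j ∈ Finset.univ.erase (0 : Fin p), u p k F ^ ((j : ℕ) - 1) • M.frob (m j),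
    M.mphi.sum_mem fun j _ => M.mphi.smul_mem _ (M.frob_mem_mphi _), ?_⟩
  change _ = decomp M.frob m - M.frob (m 0)
  rw [decomp_apply, ← Finset.add_sum_erase _ _ (Finset.mem_univ (0 : Fin p)), Fin.val_zero,
    pow_zero, one_smul, add_sub_cancel_left, Finset.smul_sum]
  refine Finset.sum_congr rfl fun j hj => ?_
  have : (j : ℕ) ≠ 0 := fun h => Finset.ne_of_mem_erase hj (Fin.ext h)
  rw [smul_smul, ← pow_succ', Nat.sub_add_cancel (Nat.pos_of_ne_zero this)]

/-- If φ(x) = u ∑ u^j φ(m_j), the cyclic shift puts u m_{p-1} in degree 0, so x = u m_{p-1} by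
uniqueness. -/
theorem exists_u_smul_of_barFrob_eq_zero [Finite k] [Finite F] {x : M.carrier}
    (hx : M.barFrob x = 0) : ∃ y, u p k F • y = x := by
  obtain ⟨y, hy, hyx⟩ := bar_mk_eq_zero.1 hx
  obtain ⟨m, rfl⟩ := exists_decomp_eq M.frob hy
  have hp : 1 < p := (Fact.out : p.Prime).one_lt
  have h1 := u_pow_smul_decomp M.frob ⟨1, hp⟩ m
  rw [pow_one, hyx] at h1
  have h2 : M.frob x = decomp M.frob (Pi.single 0 x) := by
    rw [decomp_single, Fin.val_zero, pow_zero, one_smul]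
  have h3 := congrFun (M.decomp_frob_injective (h2.symm.trans h1)) 0
  rw [Pi.single_eq_same, if_neg (by simp)] at h3
  exact ⟨_, h3.symm⟩

/-- Only m_0 survives in the reduction. For n < p it is the degree-n coefficient of u^n ∑ u^j
φ(m_j), so homogeneity puts it in `piece n`; for n ≥ p that piece is everything. -/
theorem IsHomogeneous.mem_filBar_neg [Finite k] [Finite F] (h : M.IsHomogeneous) (n : ℕ)
    (y : M.Bar) : y ∈ M.filBar (-(n : ℤ)) ↔ ∃ x ∈ M.piece n, M.barFrob x = y := by
  have hfil : ∀ z, z ∈ M.filPhi (-(n : ℤ)) ↔ z ∈ M.mphi ∧ u p k F ^ n • z ∈ M.fil 1 := by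
    intro z
    simp [filPhi]
  constructor
  · rintro ⟨⟨z, hz⟩, hz', rfl⟩
    obtain ⟨-, hz'⟩ := (hfil z).1 hz'
    obtain ⟨m, rfl⟩ := exists_decomp_eq M.frob hz
    refine ⟨m 0, ?_, (mk_decomp m).symm⟩
    rcases Nat.lt_or_ge n p with hn | hn
    · rw [show n = ((⟨n, hn⟩ : Fin p) : ℕ) from rfl, u_pow_smul_decomp] at hz'
      simpa using h _ hz' ⟨n, hn⟩
    · rw [M.piece_eq_top hn]
      trivial
  · rintro ⟨x, hx, rfl⟩
    exact ⟨⟨M.frob x, M.frob_mem_mphi x⟩, (hfil _).2 ⟨M.frob_mem_mphi x, hx⟩, rfl⟩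

/-- Because 𝓕^1 ⊂ 𝔐^φ, a positive power of u times 𝓕^1 dies modulo u𝔐^φ. -/
theorem eq_zero_of_mem_filBar_succ (n : ℕ) {y : M.Bar} (hy : y ∈ M.filBar (n + 1)) : y = 0 := by
  obtain ⟨⟨z, hz⟩, ⟨-, w, hw, hwz⟩, rfl⟩ := hy
  have h1 : ((n : ℤ) + 1).toNat = n + 1 := by omega
  have h2 : (-((n : ℤ) + 1)).toNat = 0 := by omega
  rw [h1, h2] at hwz
  refine bar_mk_eq_zero.2 ⟨u p k F ^ n • w, M.mphi.smul_mem _ (M.fil_one_le_mphi hw), ?_⟩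
  rw [smul_smul, ← pow_succ']
  simpa using hwz

theorem filBar_succ_le (M : ModF p k F e) (i : ℤ) : M.filBar (i + 1) ≤ M.filBar i := by
  refine Submodule.map_mono fun z hz => ?_
  obtain ⟨hz1, w, hw, hwz⟩ := hz
  refine ⟨hz1, ?_⟩
  rcases lt_or_ge i 0 with hi | hi
  · have h1 : (i + 1).toNat = 0 := by omega
    have h2 : i.toNat = 0 := by omega
    have h3 : (-i).toNat = (-(i + 1)).toNat + 1 := by omega
    rw [h1, pow_zero] at hwz
    rw [h2, h3, pow_zero, one_smul]
    change u p k F ^ _ • (z : M.carrier) ∈ M.fil 1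
    rw [pow_succ', mul_smul]
    refine (M.fil 1).smul_mem _ ?_
    simp only [DistribSMul.toLinearMap_apply, one_smul] at hwz
    rw [hwz] at hw
    exact hw
  · have h1 : (i + 1).toNat = i.toNat + 1 := by omega
    have h2 : (-i).toNat = 0 := by omega
    have h3 : (-(i + 1)).toNat = 0 := by omega
    rw [h1, h3] at hwz
    rw [h2]
    refine ⟨u p k F • w, (M.fil 1).smul_mem _ hw, ?_⟩
    rw [DistribSMul.toLinearMap_apply, smul_smul, ← pow_succ]
    exact hwz

theorem gr_mk_eq_zero {i : ℤ} {x : M.filBar i} :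
    (Submodule.Quotient.mk x : M.Gr i) = 0 ↔ (x : M.Bar) ∈ M.filBar (i + 1) :=
  Submodule.Quotient.mk_eq_zero _

theorem isSemisimpleModule_reduction [Finite k] [Finite F] (M : ModF p k F e) :
    IsSemisimpleModule (SF p k F)
      (M.carrier ⧸ (u p k F • (⊤ : Submodule (SF p k F) M.carrier))) := by
  refine isSemisimpleModule_of_u_smul_eq_zero _ fun x => ?_
  obtain ⟨x, rfl⟩ := Submodule.Quotient.mk_surjective _ x
  rw [← Submodule.Quotient.mk_smul, Submodule.Quotient.mk_eq_zero]
  exact ⟨x, trivial, rfl⟩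

end ModF

/-! ### Exact sequences -/

namespace Hom

variable {M N : ModF p k F e} (f : Hom M N)

theorem map_decomp (m : Fin p → M.carrier) :
    f.toLin (decomp M.frob m) = decomp N.frob fun j => f.toLin (m j) := by
  simp [decomp_apply, f.map_frob]

theorem map_piece (he : 1 ≤ e) {j : ℕ} {x : M.carrier} (hx : x ∈ M.piece j) :
    f.toLin x ∈ N.piece j := by
  have := f.map_fil 1 he _ hx
  rwa [map_smul, f.map_frob] at this

theorem onBar_barFrob (x : M.carrier) : f.onBar (M.barFrob x) = N.barFrob (f.toLin x) := by
  refine congrArg Submodule.Quotient.mk (Subtype.ext ?_)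
  exact f.map_frob x

theorem onGr_mk (he : 1 ≤ e) (i : ℤ) (x : M.filBar i) :
    f.onGr he i (Submodule.Quotient.mk x) = Submodule.Quotient.mk (f.onFilBar he i x) := rfl

end Hom

namespace ShortExact

variable {M N P : ModF p k F e} {f : Hom M N} {g : Hom N P} (hfg : ShortExact f g)

include hfg

theorem exists_of_mem_fil {i : ℕ} (hi : i ≤ e) {y : N.carrier} (hy : y ∈ N.fil i)
    (h : g.toLin y = 0) : ∃ x ∈ M.fil i, f.toLin x = y := by
  obtain ⟨x, hx⟩ := ((hfg i hi).2.1 ⟨y, hy⟩).1 (Subtype.ext h)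
  exact ⟨x, x.2, congrArg Subtype.val hx⟩

theorem exists_lift_of_mem_fil {i : ℕ} (hi : i ≤ e) {z : P.carrier} (hz : z ∈ P.fil i) :
    ∃ y ∈ N.fil i, g.toLin y = z := by
  obtain ⟨y, hy⟩ := (hfg i hi).2.2 ⟨z, hz⟩
  exact ⟨y, y.2, congrArg Subtype.val hy⟩

/-- The last filtration step is u^(e+p-1) times the whole module and u is regular, so exactness at i
= e gives exactness of the underlying modules, here and in the next three lemmas. -/
theorem injective : Function.Injective f.toLin := by
  rw [injective_iff_map_eq_zero]
  intro x hx
  have hmem : u p k F ^ (e + p - 1) • x ∈ M.fil e := by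
    rw [M.fil_e]
    exact Submodule.smul_mem_pointwise_smul _ _ _ trivial
  have := (hfg e le_rfl).1 (a₁ := ⟨_, hmem⟩) (a₂ := 0)
    (Subtype.ext (by change f.toLin (u p k F ^ _ • x) = f.toLin 0; rw [map_smul, hx]; simp))
  exact isSMulRegular_u_pow M.carrier _ ((congrArg Subtype.val this).trans (smul_zero _).symm)

theorem exists_of_map_eq_zero {y : N.carrier} (h : g.toLin y = 0) : ∃ x, f.toLin x = y := by
  have hmem : u p k F ^ (e + p - 1) • y ∈ N.fil e := by
    rw [N.fil_e]
    exact Submodule.smul_mem_pointwise_smul _ _ _ trivial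
  obtain ⟨x, hx, hxy⟩ := hfg.exists_of_mem_fil le_rfl hmem (by rw [map_smul, h, smul_zero])
  rw [M.fil_e] at hx
  obtain ⟨x, -, rfl⟩ := hx
  rw [DistribSMul.toLinearMap_apply, map_smul] at hxy
  exact ⟨x, isSMulRegular_u_pow N.carrier _ hxy⟩

theorem map_map_eq_zero (x : M.carrier) : g.toLin (f.toLin x) = 0 := by
  have hmem : u p k F ^ (e + p - 1) • x ∈ M.fil e := by
    rw [M.fil_e]
    exact Submodule.smul_mem_pointwise_smul _ _ _ trivial
  have := congrArg Subtype.val (((hfg e le_rfl).2.1 (f.onFil e le_rfl ⟨_, hmem⟩)).2 ⟨_, rfl⟩)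
  change g.toLin (f.toLin (u p k F ^ _ • x)) = 0 at this
  rw [map_smul, map_smul] at this
  exact isSMulRegular_u_pow P.carrier _ (this.trans (smul_zero _).symm)

theorem surjective : Function.Surjective g.toLin := by
  intro z
  have hmem : u p k F ^ (e + p - 1) • z ∈ P.fil e := by
    rw [P.fil_e]
    exact Submodule.smul_mem_pointwise_smul _ _ _ trivial
  obtain ⟨y, hy, hyz⟩ := hfg.exists_lift_of_mem_fil le_rfl hmem
  rw [N.fil_e] at hy
  obtain ⟨y, -, rfl⟩ := hy
  rw [DistribSMul.toLinearMap_apply, map_smul] at hyz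
  exact ⟨y, isSMulRegular_u_pow P.carrier _ hyz⟩

theorem mem_piece_of_map (he : 1 ≤ e) {j : ℕ} {x : M.carrier} (hx : f.toLin x ∈ N.piece j) :
    x ∈ M.piece j := by
  rw [ModF.mem_piece, ← f.map_frob, ← map_smul] at hx
  obtain ⟨y, hy, hyx⟩ := hfg.exists_of_mem_fil he hx (hfg.map_map_eq_zero _)
  rw [ModF.mem_piece, ← hfg.injective hyx]
  exact hy

theorem isHomogeneous_left (he : 1 ≤ e) (hN : N.IsHomogeneous) : M.IsHomogeneous := by
  intro m hm j
  refine hfg.mem_piece_of_map he (hN (fun j => f.toLin (m j)) ?_ j)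
  rw [← f.map_decomp]
  exact f.map_fil 1 he _ hm

/-- Lift the element to 𝓕^1 and decompose the lift: uniqueness in 𝔓 identifies the images of its
coefficients, and homogeneity of 𝔑 places them in the pieces. -/
theorem exists_lift_decomp [Finite k] [Finite F] (he : 1 ≤ e) (hN : N.IsHomogeneous)
    (m : Fin p → P.carrier) (hm : decomp P.frob m ∈ P.fil 1) :
    ∃ m' : Fin p → N.carrier, (∀ j, g.toLin (m' j) = m j) ∧ ∀ j : Fin p, m' j ∈ N.piece j := by
  obtain ⟨y, hy, hym⟩ := hfg.exists_lift_of_mem_fil he hm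
  obtain ⟨m', rfl⟩ := exists_decomp_eq N.frob (N.fil_one_le_mphi hy)
  rw [g.map_decomp] at hym
  exact ⟨m', congrFun (P.decomp_frob_injective hym), hN m' hy⟩

theorem isHomogeneous_right [Finite k] [Finite F] (he : 1 ≤ e) (hN : N.IsHomogeneous) :
    P.IsHomogeneous := by
  intro m hm j
  obtain ⟨m', hm', hmem⟩ := hfg.exists_lift_decomp he hN m hm
  rw [← hm' j]
  exact g.map_piece he (hmem j)

theorem exists_lift_of_mem_piece [Finite k] [Finite F] (he : 1 ≤ e) (hN : N.IsHomogeneous) (j : ℕ)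
    (x : P.carrier) (hx : x ∈ P.piece j) : ∃ y ∈ N.piece j, g.toLin y = x := by
  rcases Nat.lt_or_ge j p with hj | hj
  · obtain ⟨m', hm', hmem⟩ := hfg.exists_lift_decomp he hN (Pi.single ⟨j, hj⟩ x)
      (by rw [decomp_single]; exact hx)
    exact ⟨m' ⟨j, hj⟩, hmem ⟨j, hj⟩, by rw [hm', Pi.single_eq_same]⟩
  · obtain ⟨y, hy⟩ := hfg.surjective x
    exact ⟨y, by rw [N.piece_eq_top hj]; trivial, hy⟩

/-! ### Exactness on graded pieces -/

theorem onBar_injective : Function.Injective f.onBar := by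
  rw [injective_iff_map_eq_zero]
  intro x hx
  obtain ⟨⟨x, hxM⟩, rfl⟩ := Submodule.Quotient.mk_surjective _ x
  obtain ⟨y, hy, hyx⟩ := ModF.bar_mk_eq_zero.1 hx
  change _ = f.toLin x at hyx
  have hgy : g.toLin y = 0 := by
    have := congrArg g.toLin hyx
    rw [map_smul, hfg.map_map_eq_zero] at this
    exact isSMulRegular_u P.carrier (this.trans (smul_zero _).symm)
  obtain ⟨z, hz, rfl⟩ := hfg.exists_of_mem_fil (Nat.zero_le e) (N.fil_zero.ge hy) hgy
  rw [← map_smul] at hyx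
  exact ModF.bar_mk_eq_zero.2 ⟨z, M.fil_zero.le hz, hfg.injective hyx⟩

theorem onBar_onBar (x : M.Bar) : g.onBar (f.onBar x) = 0 := by
  obtain ⟨x, rfl⟩ := Submodule.Quotient.mk_surjective _ x
  have : g.onPhi (f.onPhi x) = 0 := Subtype.ext (hfg.map_map_eq_zero x)
  change Submodule.Quotient.mk (g.onPhi (f.onPhi x)) = 0
  rw [this]
  rfl

theorem exists_of_mem_filBar [Finite k] [Finite F] (he : 1 ≤ e) (hN : N.IsHomogeneous) (i : ℤ)
    {y : N.Bar} (hy : y ∈ N.filBar i) (h : g.onBar y = 0) : ∃ x ∈ M.filBar i, f.onBar x = y := by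
  obtain ⟨n, rfl | rfl⟩ : ∃ n : ℕ, i = -(n : ℤ) ∨ i = n + 1 :=
    ⟨if i ≤ 0 then (-i).toNat else (i - 1).toNat, by split_ifs <;> omega⟩
  · obtain ⟨x, hx, rfl⟩ := (hN.mem_filBar_neg n y).1 hy
    rw [g.onBar_barFrob] at h
    obtain ⟨z, hz⟩ := ModF.exists_u_smul_of_barFrob_eq_zero h
    obtain ⟨w, rfl⟩ := hfg.surjective z
    rw [← map_smul] at hz
    -- Correcting x by u • w moves it into the kernel without changing its class or leaving the
    -- piece.
    obtain ⟨m, hm⟩ := hfg.exists_of_map_eq_zero (y := x - u p k F • w)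
      (by rw [map_sub, hz, sub_self])
    have hmp : m ∈ M.piece n := by
      refine hfg.mem_piece_of_map he ?_
      rw [hm]
      exact (N.piece n).sub_mem hx (N.u_smul_mem_piece n w)
    refine ⟨M.barFrob m, ((hfg.isHomogeneous_left he hN).mem_filBar_neg n _).2 ⟨m, hmp, rfl⟩, ?_⟩
    have : x = f.toLin m + u p k F • w := by rw [hm]; abel
    rw [f.onBar_barFrob, this, ModF.barFrob_add, ModF.barFrob_u_smul, add_zero]
  · exact ⟨0, zero_mem _, by rw [map_zero, ModF.eq_zero_of_mem_filBar_succ n hy]⟩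

theorem exists_lift_of_mem_filBar [Finite k] [Finite F] (he : 1 ≤ e) (hN : N.IsHomogeneous) (i : ℤ)
    {z : P.Bar} (hz : z ∈ P.filBar i) : ∃ y ∈ N.filBar i, g.onBar y = z := by
  obtain ⟨n, rfl | rfl⟩ : ∃ n : ℕ, i = -(n : ℤ) ∨ i = n + 1 :=
    ⟨if i ≤ 0 then (-i).toNat else (i - 1).toNat, by split_ifs <;> omega⟩
  · obtain ⟨x, hx, rfl⟩ := ((hfg.isHomogeneous_right he hN).mem_filBar_neg n z).1 hz
    obtain ⟨y, hy, rfl⟩ := hfg.exists_lift_of_mem_piece he hN n x hx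
    exact ⟨N.barFrob y, (hN.mem_filBar_neg n _).2 ⟨y, hy, rfl⟩, g.onBar_barFrob y⟩
  · exact ⟨0, zero_mem _, by rw [map_zero, ModF.eq_zero_of_mem_filBar_succ n hz]⟩

theorem onGr_exact [Finite k] [Finite F] (he : 1 ≤ e) (hN : N.IsHomogeneous) (i : ℤ) :
    Function.Injective (f.onGr he i) ∧ Function.Exact (f.onGr he i) (g.onGr he i) ∧
      Function.Surjective (g.onGr he i) := by
  refine ⟨?_, ?_, ?_⟩
  · rw [injective_iff_map_eq_zero]
    intro x hx
    obtain ⟨x, rfl⟩ := Submodule.Quotient.mk_surjective _ x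
    have h1 : f.onBar x ∈ N.filBar (i + 1) := by
      rwa [f.onGr_mk, ModF.gr_mk_eq_zero] at hx
    obtain ⟨y, hy, hyx⟩ := hfg.exists_of_mem_filBar he hN _ h1 (hfg.onBar_onBar _)
    rw [ModF.gr_mk_eq_zero, ← hfg.onBar_injective hyx]
    exact hy
  · intro y
    constructor
    · intro hy
      obtain ⟨y, rfl⟩ := Submodule.Quotient.mk_surjective _ y
      have h1 : g.onBar y ∈ P.filBar (i + 1) := by
        rwa [g.onGr_mk, ModF.gr_mk_eq_zero] at hy
      -- Strictness one step deeper: subtracting y' ∈ Fil^(i+1) leaves the class in gr^i unchanged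
      -- and makes the element map to 0.
      obtain ⟨y', hy', hyy'⟩ := hfg.exists_lift_of_mem_filBar he hN _ h1
      have hy'i : y' ∈ N.filBar i := N.filBar_succ_le i hy'
      obtain ⟨x, hx, hxy⟩ := hfg.exists_of_mem_filBar he hN i
        ((N.filBar i).sub_mem y.2 hy'i) (by rw [map_sub, hyy', sub_self])
      refine ⟨Submodule.Quotient.mk ⟨x, hx⟩, ?_⟩
      rw [f.onGr_mk, ← sub_eq_zero, ← Submodule.Quotient.mk_sub, ModF.gr_mk_eq_zero]
      change f.onBar x - (y : N.Bar) ∈ N.filBar (i + 1)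
      rw [hxy, sub_sub_cancel_left]
      exact neg_mem hy'
    · rintro ⟨x, rfl⟩
      obtain ⟨x, rfl⟩ := Submodule.Quotient.mk_surjective _ x
      rw [f.onGr_mk, g.onGr_mk, ModF.gr_mk_eq_zero]
      change g.onBar (f.onBar x) ∈ _
      rw [hfg.onBar_onBar]
      exact zero_mem _
  · intro z
    obtain ⟨⟨z, hz⟩, rfl⟩ := Submodule.Quotient.mk_surjective _ z
    obtain ⟨y, hy, rfl⟩ := hfg.exists_lift_of_mem_filBar he hN i hz
    exact ⟨Submodule.Quotient.mk ⟨y, hy⟩, rfl⟩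

/-! ### The splitting -/

theorem exists_section [Finite k] [Finite F] (he : 1 ≤ e) (hN : N.IsHomogeneous) :
    ∃ t : P.carrier →ₗ[SF p k F] N.carrier, (∀ x, g.toLin (t x) = x) ∧
      ∀ j ≤ p, ∀ x ∈ P.piece j, t x ∈ N.piece j := by
  have := N.isSemisimpleModule_reduction
  have := P.isSemisimpleModule_reduction
  exact exists_filtered_section_of_projective (u p k F) g.toLin hfg.surjective N.piece P.piece
    N.piece_mono P.piece_mono N.u_smul_mem_piece (hfg.exists_lift_of_mem_piece he hN) p

theorem exists_onPhi_section [Finite k] [Finite F] (he : 1 ≤ e) (hN : N.IsHomogeneous) :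
    ∃ s : P.mphi →ₗ[SF p k F] N.mphi, (∀ x, g.onPhi (s x) = x) ∧
      (∀ x : P.mphi, (x : P.carrier) ∈ P.fil 1 → (s x : N.carrier) ∈ N.fil 1) ∧
      (∀ x : P.mphi, (x : P.carrier) ∈ P.phiM → (s x : N.carrier) ∈ N.phiM) := by
  obtain ⟨t, ht, htp⟩ := hfg.exists_section he hN
  -- The map s is built through its graph, the 𝔖-span of the pairs (φ(x), φ(t x)), so linearity is
  -- automatic. Unique decomposition in 𝔓^φ makes the first projection bijective.
  let θ : P.carrier →ₛₗ[phi p k F] P.carrier × N.carrier :=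
    { toFun := fun x => (P.frob x, N.frob (t x))
      map_add' := fun x y => by simp
      map_smul' := fun c x => by simp }
  have hθ : ∀ m, decomp θ m = (decomp P.frob m, decomp N.frob fun j => t (m j)) := by
    intro m
    simp only [decomp_apply]
    ext
    · simp [θ, Prod.fst_sum]
    · simp [θ, Prod.snd_sum]
  let G := Submodule.span (SF p k F) (Set.range θ)
  have hG : ∀ z : G, ∃ m, (z : P.carrier × N.carrier) =
      (decomp P.frob m, decomp N.frob fun j => t (m j)) := by
    intro z
    obtain ⟨m, hm⟩ := exists_decomp_eq θ z.2
    exact ⟨m, hm.symm.trans (hθ m)⟩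
  let fstG : G →ₗ[SF p k F] P.mphi := (LinearMap.fst _ _ _ ∘ₗ G.subtype).codRestrict P.mphi
    (by
      intro z
      obtain ⟨m, hm⟩ := hG z
      simp only [LinearMap.comp_apply, Submodule.subtype_apply, hm]
      exact P.decomp_frob_mem m)
  let sndG : G →ₗ[SF p k F] N.mphi := (LinearMap.snd _ _ _ ∘ₗ G.subtype).codRestrict N.mphi
    (by
      intro z
      obtain ⟨m, hm⟩ := hG z
      simp only [LinearMap.comp_apply, Submodule.subtype_apply, hm]
      exact N.decomp_frob_mem _)
  have hbij : Function.Bijective fstG := by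
    constructor
    · intro z z' hzz'
      obtain ⟨m, hm⟩ := hG z
      obtain ⟨m', hm'⟩ := hG z'
      have h1 : (z : P.carrier × N.carrier).1 = (z' : P.carrier × N.carrier).1 :=
        congrArg Subtype.val hzz'
      rw [hm, hm'] at h1
      obtain rfl := P.decomp_frob_injective h1
      exact Subtype.ext (hm.trans hm'.symm)
    · rintro ⟨x, hx⟩
      obtain ⟨m, rfl⟩ := exists_decomp_eq P.frob hx
      exact ⟨⟨decomp θ m, decomp_mem_span θ m⟩, Subtype.ext (congrArg Prod.fst (hθ m))⟩
  let E := LinearEquiv.ofBijective fstG hbij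
  let s := sndG ∘ₗ E.symm.toLinearMap
  have hs : ∀ m, (s ⟨decomp P.frob m, P.decomp_frob_mem m⟩ : N.carrier) =
      decomp N.frob fun j => t (m j) := by
    intro m
    let z : G := ⟨decomp θ m, decomp_mem_span θ m⟩
    have hz : E.symm ⟨decomp P.frob m, P.decomp_frob_mem m⟩ = z := by
      rw [LinearEquiv.symm_apply_eq]
      exact Subtype.ext (congrArg Prod.fst (hθ m)).symm
    change ((E.symm _ : G) : P.carrier × N.carrier).2 = _
    rw [hz]
    exact congrArg Prod.snd (hθ m)
  refine ⟨s, ?_, ?_, ?_⟩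
  · rintro ⟨x, hx⟩
    obtain ⟨m, rfl⟩ := exists_decomp_eq P.frob hx
    refine Subtype.ext ?_
    change g.toLin (s _ : N.carrier) = _
    rw [hs, g.map_decomp]
    simp only [ht]
  · rintro ⟨x, hx⟩ hxP
    obtain ⟨m, rfl⟩ := exists_decomp_eq P.frob hx
    rw [hs]
    exact N.decomp_mem_fil_one fun j =>
      htp j j.2.le _ (hfg.isHomogeneous_right he hN m hxP j)
  · rintro ⟨x, hx⟩ ⟨y, hy⟩
    have h1 : x = decomp P.frob (Pi.single 0 y) := by
      rw [decomp_single, Fin.val_zero, pow_zero, one_smul]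
      exact hy.symm
    subst h1
    rw [hs]
    refine ⟨t y, ?_⟩
    have h2 : (fun j => t ((Pi.single 0 y : Fin p → P.carrier) j)) = Pi.single 0 (t y) :=
      funext fun j => Pi.apply_single (fun _ => t) (fun _ => map_zero t) 0 y j
    rw [h2, decomp_single, Fin.val_zero, pow_zero, one_smul]

end ShortExact

end Mod

end BreuilKisin

end

theorem mainTheorem6 (p : ℕ) [Fact p.Prime] (k F : Type*) [Field k] [Finite k] [Field F] [Finite F]
    [Algebra (ZMod p) k] [Algebra (ZMod p) F] (e : ℕ) (he : 1 ≤ e)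
    (M N P : BreuilKisin.ModF p k F e)
    (f : BreuilKisin.Hom M N) (g : BreuilKisin.Hom N P) (hfg : BreuilKisin.ShortExact f g)
    (hN : N.IsStronglyDivisible) :
    (M.IsStronglyDivisible ∧ P.IsStronglyDivisible) ∧
    (∀ i : ℤ, Function.Injective (f.onGr he i) ∧ Function.Exact (f.onGr he i) (g.onGr he i) ∧
      Function.Surjective (g.onGr he i)) ∧
    (∃ s : P.mphi →ₗ[BreuilKisin.SF p k F] N.mphi,
      (∀ x, g.onPhi (s x) = x) ∧
      (∀ x : P.mphi, (x : P.carrier) ∈ P.fil 1 → (s x : N.carrier) ∈ N.fil 1) ∧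
      (∀ x : P.mphi, (x : P.carrier) ∈ P.phiM → (s x : N.carrier) ∈ N.phiM)) :=
  have hN' := hN.isHomogeneous
  ⟨⟨(hfg.isHomogeneous_left he hN').isStronglyDivisible,
    (hfg.isHomogeneous_right he hN').isStronglyDivisible⟩, hfg.onGr_exact he hN',
    hfg.exists_onPhi_section he hN'⟩
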